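/- Let $r \geq 1$, let $f : \mathbb{A}^r \to \mathbb{A}^r$ be a regular self-map over $\bar{\mathbb{Q}}$ (that is, an $r$-tuple of polynomials in $r$ variables with coefficients in $\bar{\mathbb{Q}}$), and let $P \in \mathbb{A}^r(\bar{\mathbb{Q}})$. Let $f^n$ be the $n$-th iterate of $f$, and let $h_{\mathrm{aff}}(\alpha_1,\ldots,\alpha_r) = h([1:\alpha_1:\cdots:\alpha_r])$ be the affine height, where $h$ is the absolute logarithmic Weil height. Then at least one of the following holds. (a) The Zariski closure of the orbit $\{f^nP : n \geq 0\}$ is the union of a finite set of points and of finitely many rational curves in $\mathbb{A}^r$ (irreducible Zariski-closed sets whose function field is isomorphic over $\bar{\mathbb{Q}}$ to $\bar{\mathbb{Q}}(t)$); if the orbit is infinite, then moreover for some $N$ the Zariski closure of $\{f^nP : n \geq N\}$ is the union of these rational curves alone. Furthermore there are an integer $d \geq 1$ and polynomials $p_{i,j} \in \bar{\mathbb{Q}}[x]$ $(0 \leq i < d,\ 1 \leq j \leq r)$ such that, for all sufficiently large $n$ and all $i, j$, the $j$-th coordinate of $f^{nd+i}P$ equals $p_{i,j}(n)$. (b) $$\limsup_{n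 \to \infty} \frac{\log h_{\mathrm{aff}}(f^nP)}{\log n} \geq \frac{1}{r},$$ where the limit superior is taken in $[-\infty,\infty]$ and $\log 0 = -\infty$. -/

import Mathlib

namespace OrbitGrowth

noncomputable section

open Filter

/-- The field `Q̄` of algebraic numbers. -/
abbrev QBar : Type := AlgebraicClosure ℚ

/-- The self-map of the set of `Q̄`-points of affine `r`-space given by an `r`-tuple of
polynomials. The regular self-maps of affine `r`-space over `Q̄` are exactly these. -/
def regularMap {r : ℕ} (f : Fin r → MvPolynomial (Fin r) QBar) (x : Fin r → QBar) :
    Fin r → QBar :=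
  fun i => MvPolynomial.eval x (f i)

/-- The Zariski closure of a set of points of affine `r`-space: the common zeroes of all the
polynomials that vanish on the set. -/
def zariskiClosure {r : ℕ} (S : Set (Fin r → QBar)) : Set (Fin r → QBar) :=
  MvPolynomial.zeroLocus QBar (MvPolynomial.vanishingIdeal QBar S)

/-- The coordinate ring `Q̄[x₁, …, x_r] / I(C)` of a set `C` of points. -/
abbrev coordinateRing {r : ℕ} (C : Set (Fin r → QBar)) : Type :=
  MvPolynomial (Fin r) QBar ⧸ MvPolynomial.vanishingIdeal QBar C

/-- A rational curve in affine `r`-space: an irreducible Zariski-closed set whose function field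
is isomorphic over `Q̄` to the field `Q̄(t)`, that is, which is birational to the projective
line. (That it has dimension one is a consequence.) -/
structure IsRationalCurve {r : ℕ} (C : Set (Fin r → QBar)) : Prop where
  closed : zariskiClosure C = C
  irreducible : (MvPolynomial.vanishingIdeal QBar C).IsPrime
  rational : Nonempty (FractionRing (coordinateRing C) ≃ₐ[QBar] RatFunc QBar)

/-- The field generated over `ℚ` by the coordinates of a point of affine `r`-space. -/
abbrev coordinateField {r : ℕ} (x : Fin r → QBar) : IntermediateField ℚ QBar :=
  IntermediateField.adjoin ℚ (Set.range x)

instance qBar_isAlgebraic : Algebra.IsAlgebraic ℚ QBar := by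
  have h : (DivisionRing.toRatAlgebra : Algebra ℚ QBar) = AlgebraicClosure.instAlgebra ℚ :=
    Subsingleton.elim _ _
  rw [h]
  exact AlgebraicClosure.isAlgebraic ℚ

instance coordinateField_numberField {r : ℕ} (x : Fin r → QBar) :
    NumberField (coordinateField x) where
  to_charZero := inferInstance
  to_finiteDimensional := by
    have : Finite (Set.range x) := Set.finite_range x
    have h : FiniteDimensional ℚ (coordinateField x) :=
      IntermediateField.finiteDimensional_adjoin
        (fun y _ => (Algebra.IsAlgebraic.isAlgebraic (R := ℚ) y).isIntegral)
    convert h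

/-- The homogeneous coordinates `[1 : x₁ : … : x_r]` of a point of affine `r`-space, as elements
of the field that the coordinates generate. -/
def homogeneousCoordinates {r : ℕ} (x : Fin r → QBar) : Fin (r + 1) → coordinateField x :=
  Fin.cons 1 fun i => ⟨x i, IntermediateField.subset_adjoin ℚ _ (Set.mem_range_self i)⟩

/-- The absolute logarithmic affine Weil height `h_aff(x₁, …, x_r) = h([1 : x₁ : … : x_r])`.
The function `Height.logHeight` is the logarithmic height relative to a number field `K`; the
absolute height is its quotient by `[K : ℚ]`, which is the same for all number fields `K` that
contain the coordinates. It is computed here with the smallest such `K`. -/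
def affineHeight {r : ℕ} (x : Fin r → QBar) : ℝ :=
  Height.logHeight (homogeneousCoordinates x) / (Module.finrank ℚ (coordinateField x) : ℝ)

/-- The value in `[-∞, ∞]` of `limsup (log h_aff(fⁿ P) / log n)` as `n → ∞`, where
`log 0 = -∞`. -/
def orbitGrowth {r : ℕ} (f : Fin r → MvPolynomial (Fin r) QBar) (P : Fin r → QBar) : EReal :=
  limsup
    (fun n : ℕ =>
      ENNReal.log (ENNReal.ofReal (affineHeight ((regularMap f)^[n] P))) /
        ((Real.log (n : ℝ) : ℝ) : EReal))
    atTop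

end

end OrbitGrowth

/-! Suppose that (b) fails. Then the affine height of the `n`-th orbit point is at most `C * (n + 1)
^ c` for some `c < 1 / r`, and everything may be taken over one number field `K`. Let `a` be the
sequence of the values of one coordinate along the orbit.

For almost every finite place `v`, the orbit reduces modulo `v` to an orbit on a set of `N(v) ^ r`
points, so `a` is eventually periodic modulo `v`, with preperiod plus period at most `N(v) ^ r`.
Subtracting rows one period apart shows that the `M × M` Hankel determinant of `a` is divisible by
about `M / 2` powers of `v` whenever `N(v) ^ r ≤ M / 2` (`finitePlace_hankel_det_le`). A weak prime
ideal theorem (`eventually_rpow_le_card_primes`) supplies at least `(M / 2) ^ c'` such places, for a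
chosen `c'` between `c` and `1 / r`. If the determinant were nonzero, the product formula would
force its logarithmic size to be at least of order `M ^ (1 + c')`; but the height bound limits this
size to order `M * (log M + M ^ c)`. So the Hankel determinants vanish for large `M`
(`hankel_det_eventually_eq_zero`), and by Kronecker's criterion `a` satisfies a linear recurrence
(`exists_recurrence_of_hankel_det_eq_zero`).

For a nonzero root `ρ` of the minimal recurrence, a fixed linear combination of shifts of `a` is a
nonzero multiple of `ρ ^ n`. The powers of `ρ` thus have subexponential size, and `ρ` is a root of
unity by Kronecker's theorem (`exists_pow_eq_one_of_isRoot`). Hence `a` is eventually polynomial on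
residue classes. Each class then traces integer points of a polynomially parametrized curve, and
Lüroth's theorem makes the closure of these a rational curve
(`isRationalCurve_zariskiClosure_integerPoints`). -/

open Filter Topology NumberField

/-! ### A lower bound for the number of prime ideals, by Chebyshev's method. -/

section PrimeIdealCount

variable (K : Type*) [Field K] [NumberField K]

/-- The nonzero ideals of norm at most `x`. -/
noncomputable def idealsLE (x : ℝ) : Finset (Ideal (𝓞 K)) :=
  Set.Finite.toFinset (s := {I : Ideal (𝓞 K) | I ≠ ⊥ ∧ (I.absNorm : ℝ) ≤ x}) <| by
    refine (Set.Finite.image Subtype.val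
      (Ideal.finite_setOfPred_absNorm_le₀ (S := 𝓞 K) ⌊x⌋₊)).subset ?_
    rintro I ⟨h0, h⟩
    exact ⟨⟨I, mem_nonZeroDivisors_of_ne_zero h0⟩, Nat.le_floor h, rfl⟩

variable {K} in
theorem mem_idealsLE {x : ℝ} {I : Ideal (𝓞 K)} :
    I ∈ idealsLE K x ↔ I ≠ ⊥ ∧ (I.absNorm : ℝ) ≤ x := by
  simp [idealsLE]

theorem one_le_absNorm {I : Ideal (𝓞 K)} (h : I ≠ ⊥) : (1 : ℝ) ≤ I.absNorm := by
  have : I.absNorm ≠ 0 := by rwa [Ne, Ideal.absNorm_eq_zero_iff]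
  exact_mod_cast Nat.one_le_iff_ne_zero.mpr this

theorem two_le_absNorm {I : Ideal (𝓞 K)} (h : Prime I) : (2 : ℝ) ≤ I.absNorm := by
  have h0 : I.absNorm ≠ 0 := by rw [Ne, Ideal.absNorm_eq_zero_iff]; exact h.ne_zero
  have h1 : I.absNorm ≠ 1 := by
    rw [Ne, Ideal.absNorm_eq_one_iff]; intro h'; exact h.not_isUnit (by simp [h'])
  have : 2 ≤ I.absNorm := by omega
  exact_mod_cast this

theorem exists_tendsto_card_idealsLE : ∃ κ : ℝ, 0 < κ ∧
    Tendsto (fun x : ℝ => ((idealsLE K x).card : ℝ) / x) atTop (𝓝 κ) := by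
  refine ⟨_, ?_, (NumberField.Ideal.tendsto_norm_le_div_atTop₀ K).congr fun x => ?_⟩
  · have h0 := Units.regulator_pos K
    have h1 : 0 < classNumber K := Nat.pos_of_ne_zero (classNumber_ne_zero K)
    have h2 : 0 < Units.torsionOrder K := Nat.pos_of_ne_zero (Units.torsionOrder_ne_zero K)
    have h3 : (0 : ℝ) < |discr K| := by
      exact_mod_cast abs_pos.mpr (NumberField.discr_ne_zero K)
    have h4 : 0 < √|(discr K : ℝ)| := Real.sqrt_pos.mpr (by exact_mod_cast h3)
    have h5 : (0 : ℝ) < classNumber K := by exact_mod_cast h1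
    have h6 : (0 : ℝ) < Units.torsionOrder K := by exact_mod_cast h2
    have h7 := Real.pi_pos
    exact div_pos (by positivity) (by positivity)
  · congr 2
    rw [← Nat.card_eq_finsetCard]
    refine Nat.card_congr
      { toFun := fun I => ⟨I.1.1, mem_idealsLE.mpr ⟨nonZeroDivisors.coe_ne_zero I.1, I.2⟩⟩
        invFun := fun I => ⟨⟨I.1, mem_nonZeroDivisors_of_ne_zero (mem_idealsLE.mp I.2).1⟩,
          (mem_idealsLE.mp I.2).2⟩
        left_inv := fun _ => rfl
        right_inv := fun _ => rfl }

theorem card_filter_dvd_idealsLE [DecidableEq (Ideal (𝓞 K))] {Q : Ideal (𝓞 K)} (hQ : Q ≠ ⊥) (x : ℝ)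
    [DecidablePred fun I : Ideal (𝓞 K) => Q ∣ I] :
    ((idealsLE K x).filter fun I => Q ∣ I).card = (idealsLE K (x / Q.absNorm)).card := by
  have hpos := lt_of_lt_of_le one_pos (one_le_absNorm K hQ)
  symm
  refine Finset.card_bij (fun I _ => Q * I) ?_ ?_ ?_
  · intro I hI
    rw [mem_idealsLE, le_div_iff₀' hpos] at hI
    rw [Finset.mem_filter, mem_idealsLE]
    refine ⟨⟨mul_ne_zero hQ hI.1, ?_⟩, dvd_mul_right _ _⟩
    simpa using hI.2
  · intro I _ J _ h
    exact mul_left_cancel₀ hQ h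
  · rintro I hI
    rw [Finset.mem_filter, mem_idealsLE] at hI
    obtain ⟨⟨h0, h1⟩, J, rfl⟩ := hI
    refine ⟨J, ?_, rfl⟩
    rw [mem_idealsLE, le_div_iff₀' hpos]
    exact ⟨right_ne_zero_of_mul h0, by simpa using h1⟩

open Classical in
/-- The pairs `(p, k)`, where `p` is a prime ideal, `k ≥ 1` and `p ^ k` has norm at most `x`. -/
noncomputable def primePowersLE (x : ℝ) : Finset (Ideal (𝓞 K) × ℕ) :=
  (((idealsLE K x).filter Prime) ×ˢ Finset.Icc 1 ⌊Real.logb 2 x⌋₊).filter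
    fun q => ((q.1 ^ q.2).absNorm : ℝ) ≤ x

variable {K} in
theorem mem_primePowersLE {x : ℝ} {q : Ideal (𝓞 K) × ℕ} :
    q ∈ primePowersLE K x ↔ Prime q.1 ∧ 1 ≤ q.2 ∧ ((q.1 ^ q.2).absNorm : ℝ) ≤ x := by
  simp only [primePowersLE, Finset.mem_filter, Finset.mem_product, mem_idealsLE, Finset.mem_Icc]
  constructor
  · tauto
  · rintro ⟨h1, h2, h3⟩
    have h4 := two_le_absNorm K h1
    rw [map_pow, Nat.cast_pow] at h3
    have h5 : (2 : ℝ) ^ q.2 ≤ x := le_trans (by gcongr) h3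
    have hx : 0 < x := lt_of_lt_of_le (by positivity) h5
    refine ⟨⟨⟨⟨h1.ne_zero, ?_⟩, h1⟩, h2, ?_⟩, by simpa using h3⟩
    · exact le_trans (le_self_pow₀ (by linarith) (by omega)) h3
    · apply Nat.le_floor
      rw [Real.le_logb_iff_rpow_le (by norm_num) hx]
      simpa using h5

theorem card_primePowersLE_le [DecidablePred fun I : Ideal (𝓞 K) => Prime I] {x : ℝ} (hx : 1 ≤ x) :
    ((primePowersLE K x).card : ℝ) ≤ ((idealsLE K x).filter Prime).card * (2 * Real.log x) := by
  have h1 : (primePowersLE K x).card ≤ ((idealsLE K x).filter Prime).card * ⌊Real.logb 2 x⌋₊ := by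
    refine (Finset.card_filter_le _ _).trans ?_
    rw [Finset.card_product, Nat.card_Icc, Nat.add_sub_cancel]
    apply le_of_eq
    congr!
  have h0 : 0 ≤ Real.log x := Real.log_nonneg hx
  have h2 : (⌊Real.logb 2 x⌋₊ : ℝ) ≤ 2 * Real.log x := by
    refine (Nat.floor_le (Real.logb_nonneg (by norm_num) hx)).trans ?_
    rw [Real.logb, div_le_iff₀ (Real.log_pos (by norm_num))]
    nlinarith [Real.log_two_gt_d9]
  calc ((primePowersLE K x).card : ℝ) ≤ ((idealsLE K x).filter Prime).card * ⌊Real.logb 2 x⌋₊ := by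
        exact_mod_cast h1
    _ ≤ _ := by gcongr

-- A prime `p` of multiplicity `m` in `I` is counted once for each of `p, ..., p ^ m`, so the sum is
-- the logarithm of the prime factorization.
open Classical in
theorem log_absNorm_eq_sum {x : ℝ} {I : Ideal (𝓞 K)} (hI : I ∈ idealsLE K x) :
    Real.log I.absNorm =
      ∑ q ∈ (primePowersLE K x).filter (fun q => q.1 ^ q.2 ∣ I), Real.log q.1.absNorm := by
  rw [mem_idealsLE] at hI
  obtain ⟨h0, hx⟩ := hI
  set F := UniqueFactorizationMonoid.normalizedFactors I with hF
  have hprod : F.prod = I := by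
    rw [hF, UniqueFactorizationMonoid.prod_normalizedFactors_eq h0, normalize_eq]
  have hpr : ∀ p ∈ F, Prime p := fun p hp =>
    UniqueFactorizationMonoid.prime_of_normalized_factor p hp
  have hlog : Real.log I.absNorm = ∑ p ∈ F.toFinset, F.count p * Real.log p.absNorm := by
    conv_lhs => rw [← hprod]
    rw [Finset.prod_multiset_count, map_prod, Nat.cast_prod, Real.log_prod]
    · simp
    · intro p hp
      have := hpr p (Multiset.mem_toFinset.mp hp)
      rw [map_pow, Nat.cast_pow]
      have := two_le_absNorm K this
      positivity
  rw [hlog, Finset.sum_finset_product _ F.toFinset (fun p => Finset.Icc 1 (F.count p))]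
  · simp
  · rintro ⟨p, k⟩
    simp only [Finset.mem_filter, mem_primePowersLE, Multiset.mem_toFinset, Finset.mem_Icc]
    have key : Prime p → (p ^ k ∣ I ↔ k ≤ F.count p) := fun hp => by
      rw [pow_dvd_iff_le_emultiplicity,
        UniqueFactorizationMonoid.le_emultiplicity_iff_replicate_le_normalizedFactors
          hp.irreducible h0, normalize_eq, Multiset.le_count_iff_replicate_le]
    constructor
    · rintro ⟨⟨h1, h2, h3⟩, h4⟩
      have := (key h1).1 h4
      exact ⟨Multiset.count_pos.mp (by omega), h2, this⟩
    · rintro ⟨h1, h2, h3⟩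
      have h4 := (key (hpr p h1)).2 h3
      refine ⟨⟨hpr p h1, h2, le_trans ?_ hx⟩, h4⟩
      have h5 : I.absNorm ≠ 0 := by rwa [Ne, Ideal.absNorm_eq_zero_iff]
      exact_mod_cast Nat.le_of_dvd (Nat.pos_of_ne_zero h5) (map_dvd Ideal.absNorm h4)

/-- Chebyshev's identity: the sum of the logarithms of the norms, counted by prime powers. -/
theorem sum_log_absNorm_idealsLE (x : ℝ) :
    ∑ I ∈ idealsLE K x, Real.log I.absNorm =
      ∑ q ∈ primePowersLE K x,
        Real.log q.1.absNorm * (idealsLE K (x / (q.1 ^ q.2).absNorm)).card := by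
  classical
  rw [Finset.sum_congr rfl fun I hI => log_absNorm_eq_sum K hI]
  simp_rw [Finset.sum_filter]
  rw [Finset.sum_comm]
  refine Finset.sum_congr rfl fun q hq => ?_
  rw [mem_primePowersLE] at hq
  rw [← card_filter_dvd_idealsLE K (pow_ne_zero _ hq.1.ne_zero), ← Finset.sum_filter,
    Finset.sum_const, nsmul_eq_mul, mul_comm]

theorem idealsLE_mono {x y : ℝ} (h : x ≤ y) : idealsLE K x ⊆ idealsLE K y := fun I hI => by
  rw [mem_idealsLE] at hI ⊢
  exact ⟨hI.1, hI.2.trans h⟩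

/-- The asymptotic count gives this for large `x` only. Below that range the count is bounded by
monotonicity, and it is zero for `x < 1`; this uniformity serves the prime powers whose norm is
close to `x`. -/
theorem exists_card_idealsLE_le : ∃ C : ℝ, 0 < C ∧ ∀ x : ℝ, 0 < x →
    ((idealsLE K x).card : ℝ) ≤ C * x := by
  obtain ⟨κ, hκ, hlim⟩ := exists_tendsto_card_idealsLE K
  obtain ⟨X₀, hX₀⟩ := ((hlim.eventually_le_const (lt_add_one κ)).and
    (eventually_gt_atTop 0)).exists_forall_of_atTop
  set X := max X₀ 1
  refine ⟨κ + 1 + (idealsLE K X).card, by positivity, fun x hx => ?_⟩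
  rcases le_total X x with h | h
  · obtain ⟨h1, -⟩ := hX₀ x ((le_max_left _ _).trans h)
    rw [div_le_iff₀ hx] at h1
    nlinarith [Nat.cast_nonneg (α := ℝ) (idealsLE K X).card]
  rcases le_or_gt 1 x with h' | h'
  · have h1 : ((idealsLE K x).card : ℝ) ≤ (idealsLE K X).card := by
      exact_mod_cast Finset.card_le_card (idealsLE_mono K h)
    nlinarith [Nat.cast_nonneg (α := ℝ) (idealsLE K X).card]
  · have h1 : idealsLE K x = ∅ := by
      rw [Finset.eq_empty_iff_forall_notMem]
      intro I hI
      rw [mem_idealsLE] at hI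
      linarith [one_le_absNorm K hI.1]
    rw [h1]
    simp only [Finset.card_empty, Nat.cast_zero]
    positivity

theorem sum_log_absNorm_le {x : ℝ} :
    ∑ I ∈ idealsLE K x, Real.log I.absNorm ≤ (idealsLE K x).card * Real.log x := by
  rw [← nsmul_eq_mul]
  refine Finset.sum_le_card_nsmul _ _ _ fun I hI => ?_
  rw [mem_idealsLE] at hI
  have := one_le_absNorm K hI.1
  exact Real.log_le_log (by linarith) hI.2

theorem le_sum_log_absNorm {x y : ℝ} (hy : 1 ≤ y) (hxy : y ≤ x) :
    (((idealsLE K x).card : ℝ) - (idealsLE K y).card) * Real.log y ≤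
      ∑ I ∈ idealsLE K x, Real.log I.absNorm := by
  classical
  have hsub := idealsLE_mono K hxy
  have h1 : (((idealsLE K x).card : ℝ) - (idealsLE K y).card) =
      ((idealsLE K x \ idealsLE K y).card : ℝ) := by
    rw [Finset.card_sdiff_of_subset hsub, Nat.cast_sub (Finset.card_le_card hsub)]
  rw [h1, ← nsmul_eq_mul]
  refine (Finset.card_nsmul_le_sum _ (fun I : Ideal (𝓞 K) => Real.log I.absNorm) _
    fun I hI => ?_).trans
    (Finset.sum_le_sum_of_subset_of_nonneg Finset.sdiff_subset fun I hI _ => ?_)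
  · rw [Finset.mem_sdiff, mem_idealsLE, mem_idealsLE] at hI
    refine Real.log_le_log (by linarith) ?_
    by_contra! h
    exact hI.2 ⟨hI.1.1, h.le⟩
  · exact Real.log_nonneg (one_le_absNorm K (mem_idealsLE.mp hI).1)

open Classical in
/-- Comparison of Chebyshev's identity at `x` and at `y`, when there are few prime ideals
of norm at most `x`. -/
theorem sum_log_absNorm_compare {a b C T x y : ℝ} (hT : 1 ≤ T) (ha : 0 ≤ a) (hC : 0 < C)
    (hlow : ∀ u, T ≤ u → a * u ≤ (idealsLE K u).card)
    (hupp : ∀ u, T ≤ u → ((idealsLE K u).card : ℝ) ≤ b * u)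
    (hbd : ∀ u, 0 < u → ((idealsLE K u).card : ℝ) ≤ C * u) (hy : 1 ≤ y) (hxy : y ≤ x) :
    a * y * ∑ I ∈ idealsLE K x, Real.log I.absNorm ≤
      b * x * ∑ I ∈ idealsLE K y, Real.log I.absNorm +
      a * y * ((((idealsLE K x).filter Prime).card * (2 * Real.log x)) *
        (Real.log x * (C * (x * T / y)))) := by
  have hx : 1 ≤ x := hy.trans hxy
  -- For these prime powers both `x / N` and `y / N` are at least `T`, so `hupp` applies at `x` and
  -- `hlow` at `y`. The same sum `A` then controls both sides.
  set S := (primePowersLE K x).filter (fun q => ((q.1 ^ q.2).absNorm : ℝ) ≤ y / T) with hS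
  set A := ∑ q ∈ S, Real.log q.1.absNorm / (q.1 ^ q.2).absNorm with hA
  have hb : 0 ≤ b := by
    have := (Nat.cast_nonneg _).trans (hupp T le_rfl)
    by_contra! h
    nlinarith
  have hpos : ∀ q ∈ primePowersLE K x, (0 : ℝ) < (q.1 ^ q.2).absNorm ∧
      0 ≤ Real.log q.1.absNorm ∧ Real.log q.1.absNorm ≤ Real.log x := by
    intro q hq
    rw [mem_primePowersLE] at hq
    have h2 := two_le_absNorm K hq.1
    have h3 : (q.1.absNorm : ℝ) ≤ (q.1 ^ q.2).absNorm := by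
      rw [map_pow, Nat.cast_pow]
      exact le_self_pow₀ (by linarith) (by omega)
    exact ⟨by linarith, Real.log_nonneg (by linarith),
      Real.log_le_log (by linarith) (h3.trans hq.2.2)⟩
  have h1 : ∑ I ∈ idealsLE K x, Real.log I.absNorm ≤
      b * x * A + (primePowersLE K x).card * (Real.log x * (C * (x * T / y))) := by
    rw [sum_log_absNorm_idealsLE, ← Finset.sum_filter_add_sum_filter_not _
      (fun q : Ideal (𝓞 K) × ℕ => ((q.1 ^ q.2).absNorm : ℝ) ≤ y / T)]
    refine add_le_add ?_ ?_
    · rw [hA, Finset.mul_sum]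
      refine Finset.sum_le_sum fun q hq => ?_
      rw [Finset.mem_filter] at hq
      obtain ⟨h0, h1, h2⟩ := hpos q hq.1
      have h3 : T ≤ x / (q.1 ^ q.2).absNorm := by
        rw [le_div_iff₀ h0]
        rw [le_div_iff₀ (by linarith)] at hq
        linarith [hq.2]
      calc _ ≤ Real.log q.1.absNorm * (b * (x / (q.1 ^ q.2).absNorm)) := by
            gcongr; exact hupp _ h3
        _ = _ := by ring
    -- The remaining prime powers have norm above `y / T`. Each contributes little, and their number
    -- is controlled by the number of primes.
    · have h0 : 0 ≤ Real.log x * (C * (x * T / y)) := by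
        have := Real.log_nonneg hx
        positivity
      refine (Finset.sum_le_card_nsmul _ _ (Real.log x * (C * (x * T / y))) fun q hq => ?_).trans ?_
      · rw [Finset.mem_filter, not_le] at hq
        obtain ⟨h0, h1, h2⟩ := hpos q hq.1
        have h3 : x / (q.1 ^ q.2).absNorm ≤ x * T / y := by
          rw [div_lt_iff₀ (by linarith)] at hq
          rw [div_le_div_iff₀ h0 (by linarith)]
          nlinarith [hq.2]
        have h4 := hbd (x / (q.1 ^ q.2).absNorm) (by positivity)
        have h5 := Real.log_nonneg hx
        gcongr
        exact h4.trans (by gcongr)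
      · rw [nsmul_eq_mul]
        gcongr
        exact Finset.filter_subset _ _
  have h2 : a * y * A ≤ ∑ I ∈ idealsLE K y, Real.log I.absNorm := by
    rw [sum_log_absNorm_idealsLE, hA, Finset.mul_sum]
    have hsub : S ⊆ primePowersLE K y := by
      intro q hq
      rw [hS, Finset.mem_filter, mem_primePowersLE] at hq
      rw [mem_primePowersLE]
      exact ⟨hq.1.1, hq.1.2.1, hq.2.trans (div_le_self (by linarith) hT)⟩
    refine (Finset.sum_le_sum fun q hq => ?_).trans
      (Finset.sum_le_sum_of_subset_of_nonneg hsub fun q hq _ => ?_)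
    · rw [hS, Finset.mem_filter] at hq
      obtain ⟨h0, h1, h2⟩ := hpos q hq.1
      have h3 : T ≤ y / (q.1 ^ q.2).absNorm := by
        rw [le_div_iff₀ h0]
        rw [le_div_iff₀ (by linarith)] at hq
        linarith [hq.2]
      calc _ = Real.log q.1.absNorm * (a * (y / (q.1 ^ q.2).absNorm)) := by ring
        _ ≤ _ := by gcongr; exact hlow _ h3
    · rw [mem_primePowersLE] at hq
      have := two_le_absNorm K hq.1
      have := Real.log_nonneg (show (1 : ℝ) ≤ q.1.absNorm by linarith)
      positivity
  have h3 := card_primePowersLE_le K hx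
  have h4 : 0 ≤ Real.log x * (C * (x * T / y)) := by
    have := Real.log_nonneg hx
    positivity
  have hay : 0 ≤ a * y := by positivity
  calc _ ≤ a * y * (b * x * A + (primePowersLE K x).card * (Real.log x * (C * (x * T / y)))) := by
        gcongr
    _ = b * x * (a * y * A) + a * y * ((primePowersLE K x).card *
          (Real.log x * (C * (x * T / y)))) := by ring
    _ ≤ _ := by gcongr

/-- At `η = 0` the inequality reads `κ * (1 - ε) < κ`; continuity extends it to small positive `η`.
-/
theorem exists_small_parameter {κ ε : ℝ} (hκ : 0 < κ) (hε : 0 < ε) : ∃ η : ℝ, 0 < η ∧ η < κ ∧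
    η < 1 ∧ (κ + η) / (κ - η) * (κ + η) * (1 - ε) + η < (κ - 2 * η) * (1 - η) := by
  have h1 : ContinuousAt (fun η : ℝ => (κ - 2 * η) * (1 - η) -
      ((κ + η) / (κ - η) * (κ + η) * (1 - ε) + η)) 0 := by
    have : κ - (0 : ℝ) ≠ 0 := by simpa using hκ.ne'
    fun_prop (disch := assumption)
  have h2 : (0 : ℝ) < (fun η : ℝ => (κ - 2 * η) * (1 - η) -
      ((κ + η) / (κ - η) * (κ + η) * (1 - ε) + η)) 0 := by
    have := hκ.ne'
    simp only [mul_zero, sub_zero, add_zero, mul_one, div_self this, one_mul]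
    nlinarith
  have h3 := (h1.eventually (lt_mem_nhds h2)).filter_mono (nhdsWithin_le_nhds (s := Set.Ioi 0))
  obtain ⟨η, h4, h5, h6⟩ := (h3.and ((eventually_mem_nhdsWithin).and
    ((Ioo_mem_nhdsGT (lt_min hκ one_pos))))).exists
  refine ⟨η, h5, h6.2.trans_le (min_le_left _ _), h6.2.trans_le (min_le_right _ _), by linarith⟩

open Classical in
/-- A weak form of the prime ideal theorem: there are at least `x ^ (1 - 2 * ε)` prime ideals of
norm at most `x`. -/
theorem eventually_rpow_le_card_primes {ε : ℝ} (hε : 0 < ε) (hε1 : ε < 1) :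
    ∀ᶠ x : ℝ in atTop, x ^ (1 - 2 * ε) ≤ ((idealsLE K x).filter Prime).card := by
  obtain ⟨κ, hκ, hlim⟩ := exists_tendsto_card_idealsLE K
  obtain ⟨C, hC, hbd⟩ := exists_card_idealsLE_le K
  obtain ⟨η, hη0, hηκ, hη1, hη⟩ := exists_small_parameter hκ hε
  obtain ⟨T₀, hT₀⟩ := ((hlim.eventually_le_const (show κ < κ + η by linarith)).and
    (hlim.eventually_const_le (show κ - η < κ by linarith))).exists_forall_of_atTop
  set T := max T₀ 1
  have hT1 : 1 ≤ T := le_max_right _ _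
  have hupp : ∀ u, T ≤ u → ((idealsLE K u).card : ℝ) ≤ (κ + η) * u := fun u hu =>
    (div_le_iff₀ (by linarith)).mp (hT₀ u ((le_max_left _ _).trans hu)).1
  have hlow : ∀ u, T ≤ u → (κ - η) * u ≤ (idealsLE K u).card := fun u hu =>
    (le_div_iff₀ (by linarith)).mp (hT₀ u ((le_max_left _ _).trans hu)).2
  have e1 : ∀ᶠ x : ℝ in atTop, T ≤ x ^ (1 - ε) :=
    (tendsto_rpow_atTop (by linarith)).eventually_ge_atTop T
  have e2 : ∀ᶠ x : ℝ in atTop, C / η ≤ x ^ η :=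
    (tendsto_rpow_atTop hη0).eventually_ge_atTop _
  have e3 : ∀ᶠ x : ℝ in atTop, 2 * C * T / η * Real.log x ≤ x ^ ε := by
    have h := (isLittleO_log_rpow_atTop hε).bound (show 0 < (2 * C * T / η)⁻¹ by positivity)
    filter_upwards [h, eventually_ge_atTop 1] with x hx hx1
    rw [Real.norm_of_nonneg (Real.log_nonneg hx1), Real.norm_of_nonneg (by positivity),
      inv_mul_eq_div, le_div_iff₀ (by positivity)] at hx
    linarith
  filter_upwards [e1, e2, e3, eventually_gt_atTop 1] with x h1 h2 h3 hx
  by_contra! hcon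
  set c : ℝ := (((idealsLE K x).filter Prime).card : ℝ)
  have hx0 : 0 < x := by linarith
  -- With few primes, the log-sum divided by the argument would be almost no larger at `x` than at
  -- `y`. But it is about `κ * log x` at `x` and `κ * (1 - ε) * log x` at `y`. The second `ε` in the
  -- exponent absorbs the logarithms of the error term.
  set y := x ^ (1 - ε) with hy
  have hL : 0 < Real.log x := Real.log_pos hx
  set l := Real.log x
  have hxy : y ≤ x := by
    conv_rhs => rw [← Real.rpow_one x]
    exact Real.rpow_le_rpow_of_exponent_le hx.le (by linarith)
  have hy0 : 0 < y := by positivity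
  have hcomp := sum_log_absNorm_compare K hT1 (show 0 ≤ κ - η by linarith) hC hlow hupp hbd
    (hT1.trans h1) hxy
  set Tx := ∑ I ∈ idealsLE K x, Real.log I.absNorm
  set Ty := ∑ I ∈ idealsLE K y, Real.log I.absNorm
  have hTy : Ty ≤ (κ + η) * y * ((1 - ε) * l) := by
    refine (sum_log_absNorm_le K).trans ?_
    rw [hy, Real.log_rpow hx0]
    have := hupp y h1
    have h4 : 0 ≤ (1 - ε) * l := mul_nonneg (by linarith) hL.le
    gcongr
  -- Almost all ideals of norm at most `x` have norm above `x ^ (1 - η)`.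
  have hTx : (κ - 2 * η) * x * ((1 - η) * l) ≤ Tx := by
    have h4 : x ^ (1 - η) * x ^ η = x := by
      rw [← Real.rpow_add hx0]; simp
    have h5 := le_sum_log_absNorm K (x := x) (y := x ^ (1 - η))
      (Real.one_le_rpow hx.le (by linarith)) (by
        conv_rhs => rw [← Real.rpow_one x]
        exact Real.rpow_le_rpow_of_exponent_le hx.le (by linarith))
    refine le_trans ?_ h5
    rw [Real.log_rpow hx0]
    have h6 := hlow x (h1.trans hxy)
    have h7 := hbd (x ^ (1 - η)) (by positivity)
    have h8 : C * x ^ (1 - η) ≤ η * x := by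
      rw [div_le_iff₀ hη0] at h2
      calc C * x ^ (1 - η) ≤ x ^ η * η * x ^ (1 - η) := by gcongr
        _ = η * (x ^ (1 - η) * x ^ η) := by ring
        _ = _ := by rw [h4]
    have h9 : 0 ≤ (1 - η) * l := mul_nonneg (by linarith) hL.le
    refine mul_le_mul_of_nonneg_right ?_ h9
    linarith
  have herr : (c * (2 * l)) * (l * (C * (x * T / y))) ≤ η * x * l := by
    have h4 : c ≤ x ^ (1 - 2 * ε) := hcon.le
    have h5 : x ^ (1 - 2 * ε) * x ^ ε = y := by
      rw [← Real.rpow_add hx0, hy]; congr 1; ring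
    have h6 : c * (2 * C * T * l) ≤ η * y := by
      rw [div_mul_eq_mul_div, div_le_iff₀ hη0] at h3
      calc c * (2 * C * T * l) ≤ x ^ (1 - 2 * ε) * (x ^ ε * η) := by gcongr
        _ = _ := by rw [← h5]; ring
    calc (c * (2 * l)) * (l * (C * (x * T / y))) = (c * (2 * C * T * l)) * (l * x / y) := by ring
      _ ≤ (η * y) * (l * x / y) := by gcongr
      _ = _ := by field_simp
  have hκη : 0 < κ - η := by linarith
  have hfin : (κ - η) * y * ((κ - 2 * η) * x * ((1 - η) * l)) ≤
      (κ + η) * x * ((κ + η) * y * ((1 - ε) * l)) + (κ - η) * y * (η * x * l) := by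
    calc _ ≤ (κ - η) * y * Tx := by gcongr
      _ ≤ _ := hcomp
      _ ≤ _ := by gcongr
  have hfin2 : ((κ - η) * ((κ - 2 * η) * (1 - η)) -
      ((κ + η) * (κ + η) * (1 - ε) + (κ - η) * η)) * (x * y * l) ≤ 0 := by linarith
  have hfin3 : (κ - η) * ((κ + η) / (κ - η) * (κ + η) * (1 - ε) + η) <
      (κ - η) * ((κ - 2 * η) * (1 - η)) := by gcongr
  have hfin4 : (κ - η) * ((κ + η) / (κ - η) * (κ + η) * (1 - ε) + η) =
      (κ + η) * (κ + η) * (1 - ε) + (κ - η) * η := by field_simp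
  have : 0 < x * y * l := by positivity
  nlinarith

/-- For every `ε > 0` and all sufficiently large `x` there are at least `x ^ (1 - ε)` maximal
ideals of norm at most `x`. -/
theorem eventually_exists_finset_heightOneSpectrum {ε : ℝ} (hε : 0 < ε) :
    ∀ᶠ x : ℝ in atTop, ∃ s : Finset (IsDedekindDomain.HeightOneSpectrum (𝓞 K)),
      (∀ v ∈ s, (v.asIdeal.absNorm : ℝ) ≤ x) ∧ x ^ (1 - ε) ≤ s.card := by
  classical
  -- Half of `ε` matches the exponent `1 - 2 * ε` of the prime count; the cap keeps the parameter
  -- below `1`.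
  have hδ : 0 < min (ε / 2) (1 / 2) := by positivity
  filter_upwards [eventually_rpow_le_card_primes K hδ ((min_le_right _ _).trans_lt (by norm_num)),
    eventually_ge_atTop 1] with x hx hx1
  refine ⟨((idealsLE K x).filter Prime).attach.image fun I =>
    ⟨I.1, Ideal.isPrime_of_prime (Finset.mem_filter.mp I.2).2,
      (Finset.mem_filter.mp I.2).2.ne_zero⟩, ?_, ?_⟩
  · intro v hv
    obtain ⟨I, -, rfl⟩ := Finset.mem_image.mp hv
    exact (mem_idealsLE.mp (Finset.mem_filter.mp I.2).1).2
  · rw [Finset.card_image_of_injective, Finset.card_attach]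
    · exact (Real.rpow_le_rpow_of_exponent_le hx1
        (by linarith [min_le_left (ε / 2) (1 / 2)])).trans hx
    · intro I J h
      exact Subtype.ext (congrArg IsDedekindDomain.HeightOneSpectrum.asIdeal h)

end PrimeIdealCount

/-! ### Hankel determinants and linear recurrences. -/

section Recurrence

open Polynomial

/-- The shift operator on sequences. -/
def seqShift (F : Type*) [CommRing F] : Module.End F (ℕ → F) :=
  LinearMap.funLeft F F (· + 1)

theorem seqShift_pow_apply {F : Type*} [CommRing F] (k : ℕ) (a : ℕ → F) (n : ℕ) :
    (seqShift F ^ k) a n = a (n + k) := by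
  induction k generalizing a with
  | zero => simp
  | succ k ih =>
    rw [pow_succ, Module.End.mul_apply, ih]
    simp [seqShift, LinearMap.funLeft_apply, add_assoc]

theorem aeval_seqShift_apply {F : Type*} [CommRing F] (q : F[X]) (a : ℕ → F) (n : ℕ) :
    aeval (seqShift F) q a n = ∑ k ∈ Finset.range (q.natDegree + 1), q.coeff k * a (n + k) := by
  rw [aeval_eq_sum_range, LinearMap.sum_apply, Finset.sum_apply]
  simp [seqShift_pow_apply]

/-- The Hankel matrix of size `M` of a sequence. -/
def hankel {F : Type*} (a : ℕ → F) (M : ℕ) : Matrix (Fin M) (Fin M) F :=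
  Matrix.of fun i j => a (i + j)

theorem hankel_mulVec {F : Type*} [CommRing F] (a : ℕ → F) (M : ℕ) (w : ℕ → F) (i : Fin M) :
    (hankel a M).mulVec (fun j => w j) i = ∑ j ∈ Finset.range M, a (i + j) * w j := by
  rw [Matrix.mulVec, dotProduct, ← Fin.sum_univ_eq_sum_range (fun j => a (i + j) * w j)]
  rfl

theorem exists_kernel_of_hankel_det_eq_zero {F : Type*} [Field F] {a : ℕ → F} {M : ℕ}
    (h : (hankel a M).det = 0) : ∃ w : ℕ → F, (∃ j < M, w j ≠ 0) ∧
      ∀ i < M, ∑ j ∈ Finset.range M, a (i + j) * w j = 0 := by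
  obtain ⟨v, hv, hv0⟩ := Matrix.exists_mulVec_eq_zero_iff.mpr h
  obtain ⟨j, hj⟩ := Function.ne_iff.mp hv
  let w : ℕ → F := fun j => if h : j < M then v ⟨j, h⟩ else 0
  have hw : (fun j : Fin M => w j) = v := by ext j; simp [w]
  refine ⟨w, ⟨j, j.2, by simpa [w] using hj⟩, fun i hi => ?_⟩
  rw [← hankel_mulVec a M w ⟨i, hi⟩, hw, hv0]
  rfl

/-- Kronecker's criterion: if the Hankel determinants of a sequence eventually vanish, then the
sequence satisfies a linear recurrence with constant coefficients. -/
theorem exists_recurrence_of_hankel_det_eq_zero {F : Type*} [Field F] {a : ℕ → F}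
    (h : ∃ M₀, ∀ M, M₀ ≤ M → (hankel a M).det = 0) :
    ∃ q : F[X], q ≠ 0 ∧ aeval (seqShift F) q a = 0 := by
  classical
  -- `M` is the last size with nonzero determinant; it exists because the empty determinant is `1`.
  obtain ⟨M, hM0, hM⟩ : ∃ M, (hankel a M).det ≠ 0 ∧ ∀ m, M < m → (hankel a m).det = 0 := by
    have hspec := Nat.find_spec h
    rcases Nat.eq_zero_or_pos (Nat.find h) with h0 | h0
    · have := hspec 0 h0.le
      simp [hankel] at this
    · have h1 := Nat.find_min h (Nat.sub_one_lt h0.ne')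
      push Not at h1
      obtain ⟨m, h2, h3⟩ := h1
      refine ⟨m, h3, fun k hk => hspec k (by omega)⟩
  -- the relation of order `M` that holds on the first `M` terms
  obtain ⟨c, hcM, hc⟩ : ∃ c : ℕ → F, c M = 1 ∧
      ∀ n < M, ∑ k ∈ Finset.range (M + 1), c k * a (n + k) = 0 := by
    have hunit : IsUnit (hankel a M).det := isUnit_iff_ne_zero.mpr hM0
    let v : Fin M → F := (hankel a M)⁻¹.mulVec (fun i : Fin M => -a (i + M))
    have hv : (hankel a M).mulVec v = fun i : Fin M => -a (i + M) := by
      rw [Matrix.mulVec_mulVec, Matrix.mul_nonsing_inv _ hunit, Matrix.one_mulVec]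
    let c : ℕ → F := fun j => if h : j < M then v ⟨j, h⟩ else 1
    have hcv : (fun j : Fin M => c j) = v := by ext j; simp [c]
    refine ⟨c, by simp [c], fun n hn => ?_⟩
    rw [Finset.sum_range_succ]
    have h1 := hankel_mulVec a M c ⟨n, hn⟩
    rw [hcv, hv] at h1
    have h2 : c M = 1 := by simp [c]
    simp only at h1
    rw [h2, one_mul, Finset.sum_congr rfl fun k _ => mul_comm (c k) (a (n + k)), ← h1]
    ring
  -- `b` is the defect of the recurrence, to be shown to vanish by strong induction.
  set b : ℕ → F := fun n => ∑ k ∈ Finset.range (M + 1), c k * a (n + k) with hb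
  have hb0 : ∀ n, b n = 0 := by
    intro m
    induction m using Nat.strong_induction_on with
    | _ m ih =>
      rcases lt_or_ge m M with hm | hm
      · exact hc m hm
      by_contra hbm
      obtain ⟨w, ⟨j₀, hj₀, hwj₀⟩, hw⟩ := exists_kernel_of_hankel_det_eq_zero (hM (m + 1) (by omega))
      -- The combinations of the rows of the singular matrix of size `m + 1` with coefficients `c`
      -- also annihilate `w`.
      have hbw : ∀ i, i + M ≤ m → ∑ j ∈ Finset.range (m + 1), b (i + j) * w j = 0 := by
        intro i hi
        simp only [hb, Finset.sum_mul]
        rw [Finset.sum_comm]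
        refine Finset.sum_eq_zero fun k hk => ?_
        rw [Finset.mem_range] at hk
        have := hw (i + k) (by omega)
        calc _ = c k * ∑ j ∈ Finset.range (m + 1), a (i + k + j) * w j := by
              rw [Finset.mul_sum]
              refine Finset.sum_congr rfl fun j _ => ?_
              rw [add_right_comm, mul_assoc]
          _ = 0 := by rw [this, mul_zero]
      -- Since `b` vanishes before `m` and not at `m`, the system `hbw` is triangular and kills the
      -- entries of `w` from index `M` on. What is left of `w` lies in the kernel of the nonsingular
      -- matrix of size `M`.
      have hwz : ∀ i, i + M ≤ m → w (m - i) = 0 := by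
        intro i
        induction i using Nat.strong_induction_on with
        | _ i ihi =>
          intro hi
          have h1 := hbw i hi
          rw [Finset.sum_eq_single (m - i)] at h1
          · rw [Nat.add_sub_cancel' (by omega)] at h1
            exact (mul_eq_zero.mp h1).resolve_left hbm
          · intro j hj hne
            rw [Finset.mem_range] at hj
            rcases lt_or_gt_of_ne hne with h2 | h2
            · rw [ih (i + j) (by omega), zero_mul]
            · have := ihi (m - j) (by omega) (by omega)
              rw [Nat.sub_sub_self (by omega)] at this
              rw [this, mul_zero]
          · intro h2
            exact absurd (Finset.mem_range.mpr (by omega)) h2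
      have hwz' : ∀ j, M ≤ j → j ≤ m → w j = 0 := fun j h1 h2 => by
        have := hwz (m - j) (by omega)
        rwa [Nat.sub_sub_self h2] at this
      have hker : (hankel a M).mulVec (fun j => w j) = 0 := by
        ext i
        rw [hankel_mulVec, Pi.zero_apply, ← hw i (by omega)]
        refine Finset.sum_subset (Finset.range_mono (by omega)) fun j h1 h2 => ?_
        rw [Finset.mem_range] at h1 h2
        rw [hwz' j (by omega) (by omega), mul_zero]
      have hw0 := Matrix.eq_zero_of_mulVec_eq_zero hM0 hker
      rcases lt_or_ge j₀ M with h1 | h1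
      · exact hwj₀ (congrFun hw0 ⟨j₀, h1⟩)
      · exact hwj₀ (hwz' j₀ h1 (by omega))
  refine ⟨∑ k ∈ Finset.range (M + 1), C (c k) * X ^ k, fun h0 => ?_, ?_⟩
  · have := congrArg (fun p => coeff p M) h0
    simp [finsetSum_coeff, coeff_C_mul, coeff_X_pow, hcM] at this
  · ext n
    rw [Pi.zero_apply, ← hb0 n, map_sum, LinearMap.sum_apply, Finset.sum_apply]
    refine Finset.sum_congr rfl fun k _ => ?_
    simp [seqShift_pow_apply, Module.End.mul_apply]

end Recurrence

/-! ### Divisibility of Hankel determinants at a finite place. -/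

section Determinant

variable {K : Type*} [Field K] [NumberField K]

theorem finitePlace_sum_le (v : FinitePlace K) {ι : Type*} (s : Finset ι) (f : ι → K) {B : ℝ}
    (hB : 0 ≤ B) (h : ∀ i ∈ s, v (f i) ≤ B) : v (∑ i ∈ s, f i) ≤ B := by
  classical
  induction s using Finset.induction_on with
  | empty => simpa using hB
  | insert i s hi ih =>
    rw [Finset.sum_insert hi]
    refine (v.add_le _ _).trans (max_le (h i (Finset.mem_insert_self _ _))
      (ih fun j hj => h j (Finset.mem_insert_of_mem hj)))

/-- The ultrametric inequality removes any factorial from the Leibniz expansion, so the bounds of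
the rows simply multiply. -/
theorem finitePlace_det_le (v : FinitePlace K) {n : Type*} [Fintype n] [DecidableEq n]
    (A : Matrix n n K) (β : n → ℝ) (hβ : ∀ i, 0 ≤ β i) (h : ∀ i j, v (A i j) ≤ β i) :
    v A.det ≤ ∏ i, β i := by
  rw [Matrix.det_apply]
  refine finitePlace_sum_le v _ _ (Finset.prod_nonneg fun i _ => hβ i) fun σ _ => ?_
  have h1 : v (Equiv.Perm.sign σ • ∏ i, A (σ i) i) = ∏ i, v (A (σ i) i) := by
    rw [FinitePlace.coe_apply, AbsoluteValue.map_units_int_smul, map_prod]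
    rfl
  rw [h1, ← Equiv.prod_comp σ β]
  exact Finset.prod_le_prod (fun i _ => apply_nonneg _ _) fun i _ => h _ _

/-- If a sequence of `v`-integers is eventually periodic modulo `v`, then its Hankel determinants
are highly divisible by `v`. -/
theorem finitePlace_hankel_det_le (v : FinitePlace K) {a : ℕ → K} {β : ℝ} (hβ : 0 ≤ β)
    (ha : ∀ n, v (a n) ≤ 1) {s t k : ℕ} (hk : 0 < k) (hs : t + k ≤ s)
    (hper : ∀ n, t ≤ n → v (a (n + k) - a n) ≤ β) (M : ℕ) :
    v (hankel a M).det ≤ β ^ (M - s) := by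
  -- Multiplication by this unipotent matrix subtracts row `i - k` from row `i` for each `i ≥ s`. As
  -- `s ≥ t + k`, periodicity bounds all entries of these `M - s` rows by `β`.
  let U : Matrix (Fin M) (Fin M) K := Matrix.of fun i j =>
    if i = j then 1 else if s ≤ (i : ℕ) ∧ (j : ℕ) + k = i then -1 else 0
  have hU : U.det = 1 := by
    rw [Matrix.det_of_isLowerTriangular]
    · simp [U]
    · intro i j hij
      have hij' : (i : ℕ) < j := by simpa using hij
      have h1 : i ≠ j := by intro h; rw [h] at hij'; exact lt_irrefl _ hij'
      simp only [U, Matrix.of_apply]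
      rw [if_neg h1, if_neg (by omega)]
  have hmul : ∀ i j : Fin M, (U * hankel a M) i j =
      if s ≤ (i : ℕ) then a (i + j) - a (i - k + j) else a (i + j) := by
    intro i j
    rw [Matrix.mul_apply]
    split_ifs with hi
    · have hik : (i : ℕ) - k < M := by omega
      have hne : (⟨i - k, hik⟩ : Fin M) ≠ i := by
        intro h
        have := congrArg Fin.val h
        simp only at this
        omega
      rw [Finset.sum_eq_add_of_mem i ⟨i - k, hik⟩ (Finset.mem_univ _) (Finset.mem_univ _) hne.symm]
      · simp only [U, hankel, Matrix.of_apply, if_true]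
        rw [if_neg hne.symm, if_pos ⟨hi, by omega⟩]
        ring
      · rintro l - ⟨h1, h2⟩
        simp only [U, Matrix.of_apply]
        rw [if_neg h1.symm, if_neg, zero_mul]
        rintro ⟨-, h3⟩
        apply h2
        ext
        simp only
        omega
    · rw [Finset.sum_eq_single i]
      · simp [U, hankel]
      · intro l _ h1
        simp only [U, Matrix.of_apply]
        rw [if_neg h1.symm, if_neg (by tauto), zero_mul]
      · simp
  have hdet : (hankel a M).det = (U * hankel a M).det := by rw [Matrix.det_mul, hU, one_mul]
  rw [hdet]
  refine (finitePlace_det_le v _ (fun i : Fin M => if s ≤ (i : ℕ) then β else 1)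
    (fun i => by split_ifs <;> positivity) fun i j => ?_).trans ?_
  · rw [hmul]
    split_ifs with hi
    · have := hper (i - k + j) (by omega)
      rwa [show (i : ℕ) - k + j + k = i + j by omega] at this
    · exact ha _
  · rw [Fin.prod_univ_eq_prod_range (fun i => if s ≤ i then β else 1) M, Finset.prod_ite,
      Finset.prod_const_one, mul_one, Finset.prod_const]
    apply le_of_eq
    have : (Finset.range M).filter (fun i => s ≤ i) = Finset.Ico s M := by
      ext i
      simp [and_comm]
    rw [this, Nat.card_Ico]

end Determinant

/-! ### Periodicity of orbits modulo a finite place. -/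

section ReductionOfOrbits

variable {K : Type*} [Field K] [NumberField K]

/-- The norm of the maximal ideal that corresponds to a finite place. -/
noncomputable def placeNorm (v : FinitePlace K) : ℕ := v.maximalIdeal.asIdeal.absNorm

theorem two_le_placeNorm (v : FinitePlace K) : 2 ≤ placeNorm v := by
  exact_mod_cast two_le_absNorm K v.maximalIdeal.prime

theorem finitePlace_integer_le_one (v : FinitePlace K) (a : 𝓞 K) : v (algebraMap (𝓞 K) K a) ≤ 1 := by
  rw [← FinitePlace.norm_embedding_eq]
  exact FinitePlace.norm_le_one K _ a

theorem finitePlace_integer_le_of_mem (v : FinitePlace K) {a : 𝓞 K}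
    (ha : a ∈ v.maximalIdeal.asIdeal) : v (algebraMap (𝓞 K) K a) ≤ (placeNorm v : ℝ)⁻¹ := by
  have hN : (2 : ℝ) ≤ placeNorm v := by exact_mod_cast two_le_placeNorm v
  rcases eq_or_ne a 0 with rfl | h0
  · simp
  have h1 := FinitePlace.apply_mul_absNorm_pow_eq_one v h0
  have h2 : multiplicity v.maximalIdeal.asIdeal (Ideal.span {a}) ≠ 0 := by
    rw [Ne, multiplicity_eq_zero, not_not, Ideal.dvd_span_singleton]
    exact ha
  refine (eq_inv_of_mul_eq_one_left h1).trans_le ?_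
  apply inv_anti₀ (by linarith)
  unfold placeNorm at hN ⊢
  exact le_self_pow₀ (by linarith) h2

theorem finitePlace_integer_eq_one_iff (v : FinitePlace K) (a : 𝓞 K) :
    v (algebraMap (𝓞 K) K a) = 1 ↔ a ∉ v.maximalIdeal.asIdeal := by
  rw [← FinitePlace.norm_embedding_eq]
  exact FinitePlace.norm_eq_one_iff_notMem K _ a

/-- The local ring of a finite place, as fractions of algebraic integers whose denominator is a
unit at the place. -/
def placeLocalRing (v : FinitePlace K) : Subring K where
  carrier := {x | ∃ a b : 𝓞 K, v (algebraMap (𝓞 K) K b) = 1 ∧ x * algebraMap (𝓞 K) K b = algebraMap (𝓞 K) K a}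
  zero_mem' := ⟨0, 1, by simp, by simp⟩
  one_mem' := ⟨1, 1, by simp, by simp⟩
  add_mem' := by
    rintro x y ⟨a, b, hb, h⟩ ⟨c, d, hd, h'⟩
    refine ⟨a * d + c * b, b * d, by simp [hb, hd], ?_⟩
    simp only [map_mul, map_add, ← h, ← h']
    ring
  mul_mem' := by
    rintro x y ⟨a, b, hb, h⟩ ⟨c, d, hd, h'⟩
    refine ⟨a * c, b * d, by simp [hb, hd], ?_⟩
    simp only [map_mul, ← h, ← h']
    ring
  neg_mem' := by
    rintro x ⟨a, b, hb, h⟩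
    refine ⟨-a, b, hb, ?_⟩
    simp only [map_neg, ← h]
    ring

theorem le_one_of_mem_placeLocalRing {v : FinitePlace K} {x : K} (hx : x ∈ placeLocalRing v) :
    v x ≤ 1 := by
  obtain ⟨a, b, hb, h⟩ := hx
  have := finitePlace_integer_le_one v a
  rwa [← h, map_mul, hb, mul_one] at this

theorem exists_integer_near_of_mem_placeLocalRing {v : FinitePlace K} {x : K}
    (hx : x ∈ placeLocalRing v) : ∃ y : 𝓞 K, v (x - algebraMap (𝓞 K) K y) ≤ (placeNorm v : ℝ)⁻¹ := by
  obtain ⟨a, b, hb, h⟩ := hx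
  have hb' := (finitePlace_integer_eq_one_iff v b).mp hb
  obtain ⟨c, i, hi, hc⟩ := v.maximalIdeal.isMaximal.exists_inv hb'
  refine ⟨c * a, ?_⟩
  have h1 : algebraMap (𝓞 K) K c * algebraMap (𝓞 K) K b + algebraMap (𝓞 K) K i = 1 := by
    rw [← map_mul, ← map_add, hc, map_one]
  have h2 : x - algebraMap (𝓞 K) K (c * a) = x * algebraMap (𝓞 K) K i := by
    rw [map_mul, ← h]
    linear_combination -x * h1
  rw [h2, map_mul]
  have h3 := le_one_of_mem_placeLocalRing (v := v) ⟨a, b, hb, h⟩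
  have h4 := finitePlace_integer_le_of_mem v hi
  calc v x * v (algebraMap (𝓞 K) K i) ≤ 1 * (placeNorm v : ℝ)⁻¹ := by
        gcongr
    _ = _ := one_mul _

/-- A denominator of `x` in `𝓞 K` is a unit at all but finitely many places. -/
theorem finite_setOf_notMem_placeLocalRing (x : K) :
    {v : FinitePlace K | x ∉ placeLocalRing v}.Finite := by
  obtain ⟨a, b, hb, rfl⟩ := IsFractionRing.div_surjective (𝓞 K) x
  have hb0 : b ≠ 0 := nonZeroDivisors.ne_zero hb
  refine (FinitePlace.hasFiniteMulSupport_int hb0).subset fun v hv => ?_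
  rw [Function.mem_mulSupport]
  intro h1
  refine hv ⟨a, b, h1, ?_⟩
  have : algebraMap (𝓞 K) K b ≠ 0 := by simpa using hb0
  exact div_mul_cancel₀ _ this

/-- Pairs of `v`-integers that are congruent up to `β`. -/
def congruentPairs (v : FinitePlace K) (β : ℝ) (hβ : 0 ≤ β) : Subring (K × K) where
  carrier := {z | v z.1 ≤ 1 ∧ v z.2 ≤ 1 ∧ v (z.1 - z.2) ≤ β}
  zero_mem' := by simp [hβ]
  one_mem' := by simp [hβ]
  add_mem' := by
    rintro ⟨a, b⟩ ⟨c, d⟩ ⟨h1, h2, h3⟩ ⟨h4, h5, h6⟩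
    refine ⟨(v.add_le _ _).trans (max_le h1 h4), (v.add_le _ _).trans (max_le h2 h5), ?_⟩
    have : (a, b).1 + (c, d).1 - ((a, b).2 + (c, d).2) = (a - b) + (c - d) := by
      simp only; ring
    exact (congrArg v this).trans_le ((v.add_le _ _).trans (max_le h3 h6))
  mul_mem' := by
    rintro ⟨a, b⟩ ⟨c, d⟩ ⟨h1, h2, h3⟩ ⟨h4, h5, h6⟩
    simp only at h1 h2 h3 h4 h5 h6
    refine ⟨?_, ?_, ?_⟩
    · simp only [Prod.mk_mul_mk, map_mul]
      exact mul_le_one₀ h1 (apply_nonneg _ _) h4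
    · simp only [Prod.mk_mul_mk, map_mul]
      exact mul_le_one₀ h2 (apply_nonneg _ _) h5
    · have : ((a, b) * (c, d)).1 - ((a, b) * (c, d)).2 = a * (c - d) + d * (a - b) := by
        simp only [Prod.mk_mul_mk]; ring
      refine (congrArg v this).trans_le ((v.add_le _ _).trans (max_le ?_ ?_))
      · rw [map_mul]
        exact (mul_le_of_le_one_left (apply_nonneg _ _) h1).trans h6
      · rw [map_mul]
        exact (mul_le_of_le_one_left (apply_nonneg _ _) h5).trans h3
  neg_mem' := by
    rintro ⟨a, b⟩ ⟨h1, h2, h3⟩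
    refine ⟨by simpa using h1, by simpa using h2, ?_⟩
    have : (-(a, b)).1 - (-(a, b)).2 = -(a - b) := by simp only [Prod.neg_mk]; ring
    exact (congrArg v this).trans_le ((map_neg_eq_map v _).trans_le h3)

/-- Congruent pairs form a subring of `K × K`, and polynomial evaluation stays inside it. -/
theorem eval_sub_eval_le {σ : Type*} {v : FinitePlace K} {β : ℝ} (hβ : 0 ≤ β)
    {p : MvPolynomial σ K} (hp : ∀ d ∈ p.support, v (p.coeff d) ≤ 1) {x y : σ → K}
    (hx : ∀ i, v (x i) ≤ 1) (hy : ∀ i, v (y i) ≤ 1) (hxy : ∀ i, v (x i - y i) ≤ β) :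
    v (MvPolynomial.eval x p - MvPolynomial.eval y p) ≤ β := by
  have h : (MvPolynomial.eval x p, MvPolynomial.eval y p) ∈ congruentPairs v β hβ := by
    have h1 : (MvPolynomial.eval x p, MvPolynomial.eval y p) =
        ∑ d ∈ p.support, (p.coeff d, p.coeff d) * ∏ i ∈ d.support, (x i, y i) ^ d i := by
      rw [MvPolynomial.eval_eq, MvPolynomial.eval_eq]
      ext <;> simp [Prod.fst_sum, Prod.snd_sum, Prod.fst_prod, Prod.snd_prod]
    rw [h1]
    have h2 : ∀ d ∈ p.support, (p.coeff d, p.coeff d) ∈ congruentPairs v β hβ := fun d hd =>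
      ⟨hp d hd, hp d hd, by simpa using hβ⟩
    have h3 : ∀ i, (x i, y i) ∈ congruentPairs v β hβ := fun i => ⟨hx i, hy i, hxy i⟩
    exact sum_mem fun d hd => mul_mem (h2 d hd) (prod_mem fun i _ => pow_mem (h3 i) _)
  exact h.2.2

theorem eval_mem_placeLocalRing {σ : Type*} {v : FinitePlace K} {p : MvPolynomial σ K}
    (hp : ∀ d ∈ p.support, p.coeff d ∈ placeLocalRing v) {x : σ → K}
    (hx : ∀ i, x i ∈ placeLocalRing v) : MvPolynomial.eval x p ∈ placeLocalRing v := by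
  rw [MvPolynomial.eval_eq]
  exact sum_mem fun d hd => mul_mem (hp d hd) (prod_mem fun i _ => pow_mem (hx i) _)

/-- An orbit in the local ring of a finite place is periodic modulo the maximal ideal, with
preperiod and period bounded by the number of points of the reduction. -/
theorem exists_period_of_orbit {r : ℕ} {v : FinitePlace K} {F : Fin r → MvPolynomial (Fin r) K}
    (hF : ∀ i, ∀ d ∈ (F i).support, (F i).coeff d ∈ placeLocalRing v) {x : ℕ → Fin r → K}
    (hx0 : ∀ i, x 0 i ∈ placeLocalRing v)
    (hx : ∀ n i, x (n + 1) i = MvPolynomial.eval (x n) (F i)) :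
    (∀ n i, v (x n i) ≤ 1) ∧ ∃ t k : ℕ, 0 < k ∧ t + k ≤ placeNorm v ^ r ∧
      ∀ n, t ≤ n → ∀ i, v (x (n + k) i - x n i) ≤ (placeNorm v : ℝ)⁻¹ := by
  have hN := two_le_placeNorm v
  have hmem : ∀ n i, x n i ∈ placeLocalRing v := by
    intro n
    induction n with
    | zero => exact hx0
    | succ n ih => intro i; rw [hx]; exact eval_mem_placeLocalRing (hF i) ih
  have hle : ∀ n i, v (x n i) ≤ 1 := fun n i => le_one_of_mem_placeLocalRing (hmem n i)
  refine ⟨hle, ?_⟩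
  have hβ : (0 : ℝ) ≤ (placeNorm v : ℝ)⁻¹ := by positivity
  choose y hy using fun n i => exists_integer_near_of_mem_placeLocalRing (hmem n i)
  let k := 𝓞 K ⧸ v.maximalIdeal.asIdeal
  have hcard : Nat.card k = placeNorm v := by
    rw [placeNorm, Ideal.absNorm_apply, Submodule.cardQuot_apply]
  have hfin : Finite k := Nat.finite_of_card_ne_zero (by rw [hcard]; omega)
  have := Fintype.ofFinite k
  -- There is one more index than there are points over the residue field, so two of these
  -- reductions agree. The congruence then propagates along the orbit.
  let red : Fin (placeNorm v ^ r + 1) → Fin r → k := fun n i => Ideal.Quotient.mk _ (y n i)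
  obtain ⟨n₁, n₂, hne, heq⟩ := Fintype.exists_ne_map_eq_of_card_lt red (by
    rw [Fintype.card_fun, Fintype.card_fin, Fintype.card_fin, Fintype.card_eq_nat_card, hcard]
    omega)
  wlog hlt : n₁ < n₂ generalizing n₁ n₂
  · exact this n₂ n₁ hne.symm heq.symm (lt_of_le_of_ne (not_lt.mp hlt) hne.symm)
  have hlt' : (n₁ : ℕ) < n₂ := hlt
  have hn₂ := n₂.2
  refine ⟨n₁, n₂ - n₁, by omega, by omega, fun n hn => ?_⟩
  induction n, hn using Nat.le_induction with
  | base =>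
    intro i
    rw [Nat.add_sub_cancel' hlt'.le]
    have h1 : y n₂ i - y n₁ i ∈ v.maximalIdeal.asIdeal :=
      Ideal.Quotient.eq.mp (congrFun heq i).symm
    have h2 := finitePlace_integer_le_of_mem v h1
    have h3 : x n₂ i - x n₁ i = (x n₂ i - algebraMap (𝓞 K) K (y n₂ i)) + ((algebraMap (𝓞 K) K (y n₂ i - y n₁ i)) +
        -(x n₁ i - algebraMap (𝓞 K) K (y n₁ i))) := by
      rw [map_sub]; ring
    rw [h3]
    refine (v.add_le _ _).trans (max_le (hy _ _) ((v.add_le _ _).trans (max_le h2 ?_)))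
    rw [map_neg_eq_map]
    exact hy _ _
  | succ n hn ih =>
    intro i
    rw [add_right_comm, hx, hx]
    exact eval_sub_eval_le hβ (fun d hd => le_one_of_mem_placeLocalRing (hF i d hd))
      (hle _) (hle _) ih

end ReductionOfOrbits

/-! ### Vanishing of Hankel determinants by the product formula. -/

section HankelVanishing

theorem hankel_det_le {K : Type*} [Field K] {a : ℕ → K} (v : AbsoluteValue K ℝ) {C c : ℝ} (hC : 0 ≤ C) (hc : 0 ≤ c)
    (hv : ∀ n : ℕ, v (a n) ≤ Real.exp (C * (n + 1 : ℝ) ^ c)) (M : ℕ) :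
    v (hankel a M).det ≤ M.factorial * Real.exp (C * (2 * M : ℝ) ^ c) ^ M := by
  have h := Matrix.det_le (A := hankel a M) (abv := v) (x := Real.exp (C * (2 * M : ℝ) ^ c))
    fun i j => by
      refine (hv (i + j)).trans ?_
      have h1 : ((i + j : ℕ) : ℝ) + 1 ≤ 2 * M := by
        have : (i : ℕ) + j + 1 ≤ 2 * M := by omega
        exact_mod_cast this
      have h2 : (0 : ℝ) ≤ ((i + j : ℕ) : ℝ) + 1 := by positivity
      gcongr
  simpa using h

variable {K : Type*} [Field K] [NumberField K]

/-- The product formula bounds the number of places at which a nonzero Hankel determinant is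
highly divisible. -/
theorem card_mul_le_of_hankel_det_ne_zero {a : ℕ → K} {r : ℕ} {S : Finset (FinitePlace K)}
    (hS : ∀ v ∉ S, (∀ n, v (a n) ≤ 1) ∧ ∃ t k : ℕ, 0 < k ∧ t + k ≤ placeNorm v ^ r ∧
      ∀ n, t ≤ n → v (a (n + k) - a n) ≤ (placeNorm v : ℝ)⁻¹)
    {C c : ℝ} (hC : 0 ≤ C) (hc : 0 ≤ c)
    (hinf : ∀ (w : InfinitePlace K) (n : ℕ), w (a n) ≤ Real.exp (C * (n + 1 : ℝ) ^ c))
    (hfin : ∀ (v : FinitePlace K) (n : ℕ), v (a n) ≤ Real.exp (C * (n + 1 : ℝ) ^ c))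
    {M : ℕ} (hM : 0 < M) (hdet : (hankel a M).det ≠ 0) {s : Finset (FinitePlace K)}
    (hs : ∀ v ∈ s, placeNorm v ^ r ≤ M / 2) :
    ((s.card : ℝ) - S.card) * (M / 2) * Real.log 2 ≤
      ((Module.finrank ℚ K : ℝ) + S.card) * (M * (Real.log M + C * (2 * M : ℝ) ^ c)) := by
  classical
  set Δ := (hankel a M).det
  set B : ℝ := M.factorial * Real.exp (C * (2 * M : ℝ) ^ c) ^ M with hB
  have hfac : (1 : ℝ) ≤ M.factorial := by exact_mod_cast Nat.succ_le_of_lt M.factorial_pos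
  have hexp : 1 ≤ Real.exp (C * (2 * M : ℝ) ^ c) := Real.one_le_exp (by positivity)
  have hB1 : 1 ≤ B := one_le_mul_of_one_le_of_one_le hfac (one_le_pow₀ hexp)
  have hlogB : Real.log B ≤ M * (Real.log M + C * (2 * M : ℝ) ^ c) := by
    rw [hB, Real.log_mul (by positivity) (by positivity), Real.log_pow, Real.log_exp, mul_add]
    gcongr
    rw [← Real.log_pow]
    exact Real.log_le_log (by positivity) (by exact_mod_cast Nat.factorial_le_pow M)
  have hinfB : ∀ w : InfinitePlace K, w Δ ≤ B := fun w => hankel_det_le w.1 hC hc (hinf w) M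
  have hfinB : ∀ v : FinitePlace K, v Δ ≤ B := fun v => hankel_det_le v.1 hC hc (hfin v) M
  set e := M - M / 2
  -- At least `e` rows gain a factor `N(v)⁻¹`; the crude bound `1 / 2` for this factor suffices.
  have hgood : ∀ v ∉ S, v Δ ≤ 1 ∧ (v ∈ s → v Δ ≤ (1 / 2 : ℝ) ^ e) := by
    intro v hv
    obtain ⟨h1, t, k, hk, htk, hper⟩ := hS v hv
    have hN : (2 : ℝ) ≤ placeNorm v := by exact_mod_cast two_le_placeNorm v
    have hβ : (placeNorm v : ℝ)⁻¹ ≤ 1 / 2 := by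
      rw [inv_le_comm₀ (by linarith) (by norm_num)]; norm_num; exact two_le_placeNorm v
    have hβ0 : (0 : ℝ) ≤ (placeNorm v : ℝ)⁻¹ := by positivity
    have h2 := finitePlace_hankel_det_le v hβ0 h1 hk htk hper M
    refine ⟨h2.trans (pow_le_one₀ hβ0 (by linarith)), fun hvs => h2.trans ?_⟩
    have h3 : e ≤ M - placeNorm v ^ r := by have := hs v hvs; omega
    calc ((placeNorm v : ℝ)⁻¹) ^ (M - placeNorm v ^ r) ≤ (placeNorm v : ℝ)⁻¹ ^ e :=
          pow_le_pow_of_le_one hβ0 (by linarith) h3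
      _ ≤ _ := by gcongr
  have hprod := prod_abs_eq_one hdet
  set W := (FinitePlace.hasFiniteMulSupport hdet).toFinset ∪ S ∪ s
  have hW : Function.mulSupport (fun v : FinitePlace K => v Δ) ⊆ (W : Set (FinitePlace K)) := by
    intro v hv
    simp only [W, Finset.coe_union]
    exact Or.inl (Or.inl (Finset.mem_coe.mpr ((Set.Finite.mem_toFinset _).mpr hv)))
  rw [finprod_eq_prod_of_mulSupport_subset _ hW] at hprod
  -- Bad places cost at most `B` each, good places of small norm gain `(1 / 2) ^ e` each, and the
  -- others contribute at most `1`.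
  have hfinprod : ∏ v ∈ W, v Δ ≤ B ^ S.card * ((1 / 2 : ℝ) ^ e) ^ (s \ S).card := by
    calc ∏ v ∈ W, v Δ ≤ ∏ v ∈ W, ((if v ∈ S then B else 1) *
          (if v ∈ s \ S then (1 / 2 : ℝ) ^ e else 1)) := by
          refine Finset.prod_le_prod (fun v _ => apply_nonneg _ _) fun v _ => ?_
          by_cases hv : v ∈ S
          · simpa [hv] using hfinB v
          · by_cases hvs : v ∈ s
            · simpa [hv, hvs] using (hgood v hv).2 hvs
            · simpa [hv, hvs] using (hgood v hv).1
      _ = _ := by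
          rw [Finset.prod_mul_distrib, Finset.prod_ite_mem, Finset.prod_ite_mem,
            Finset.prod_const, Finset.prod_const]
          congr 3
          · exact Finset.inter_eq_right.mpr (fun v hv => by simp [W, hv])
          · exact Finset.inter_eq_right.mpr (fun v hv => by
              simp only [W, Finset.mem_union]
              exact Or.inr (Finset.mem_sdiff.mp hv).1)
  have hinfprod : ∏ w : InfinitePlace K, w Δ ^ w.mult ≤ B ^ Module.finrank ℚ K := by
    rw [← InfinitePlace.sum_mult_eq, ← Finset.prod_pow_eq_pow_sum]
    exact Finset.prod_le_prod (fun w _ => pow_nonneg (apply_nonneg _ _) _) fun w _ =>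
      pow_le_pow_left₀ (apply_nonneg _ _) (hinfB w) _
  have hmain : 1 ≤ B ^ Module.finrank ℚ K * (B ^ S.card * ((1 / 2 : ℝ) ^ e) ^ (s \ S).card) := by
    refine hprod.symm.trans_le ?_
    refine mul_le_mul hinfprod hfinprod (Finset.prod_nonneg fun v _ => apply_nonneg _ _)
      (by positivity)
  have hlog := Real.log_le_log one_pos hmain
  have hBpos : 0 < B := by linarith
  rw [Real.log_one, Real.log_mul (by positivity) (by positivity),
    Real.log_mul (by positivity) (by positivity), Real.log_pow, Real.log_pow, Real.log_pow,
    Real.log_pow, one_div, Real.log_inv] at hlog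
  have hlog2 : 0 < Real.log 2 := Real.log_pos (by norm_num)
  have hcard : (s.card : ℝ) - S.card ≤ (s \ S).card := by
    have := Finset.le_card_sdiff S s
    have h2 : s.card ≤ (s \ S).card + S.card := by omega
    have h3 : (s.card : ℝ) ≤ (s \ S).card + S.card := by exact_mod_cast h2
    linarith
  have he : (M : ℝ) / 2 ≤ e := by
    have h1 : M ≤ 2 * e := by omega
    have h2 : (M : ℝ) ≤ 2 * e := by exact_mod_cast h1
    linarith
  calc ((s.card : ℝ) - S.card) * (M / 2) * Real.log 2
      ≤ (s \ S).card * (M / 2) * Real.log 2 := by gcongr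
    _ ≤ (s \ S).card * e * Real.log 2 := by gcongr
    _ ≤ ((Module.finrank ℚ K : ℝ) + S.card) * Real.log B := by linarith
    _ ≤ _ := by gcongr

theorem isLittleO_rpow_rpow_atTop {c c' : ℝ} (h : c < c') :
    (fun x : ℝ => x ^ c) =o[atTop] fun x : ℝ => x ^ c' := by
  refine (Asymptotics.isLittleO_iff_tendsto' ?_).mpr
    ((tendsto_rpow_neg_atTop (sub_pos.mpr h)).congr' ?_)
  · filter_upwards [eventually_gt_atTop 0] with x hx h0
    exact absurd h0 (Real.rpow_pos_of_pos hx _).ne'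
  · filter_upwards [eventually_gt_atTop 0] with x hx
    rw [← Real.rpow_sub hx, neg_sub]

theorem eventually_log_add_rpow_lt {A C c c' E : ℝ} (hc : 0 < c) (hcc : c < c') :
    ∀ᶠ M : ℕ in atTop, A * (Real.log M + C * (2 * M : ℝ) ^ c) + E <
      ((M : ℝ) / 2) ^ c' := by
  have hc' : 0 < c' := hc.trans hcc
  have h : (fun t : ℝ => A * (Real.log t + C * (2 ^ c * t ^ c)) + E) =o[atTop]
      fun t : ℝ => t ^ c' :=
    (((isLittleO_log_rpow_atTop hc').add
      (((isLittleO_rpow_rpow_atTop hcc).const_mul_left (2 ^ c)).const_mul_left C)).const_mul_left A).add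
      (Asymptotics.isLittleO_const_left.mpr (Or.inr
        (tendsto_norm_atTop_atTop.comp (tendsto_rpow_atTop hc'))))
  have h2 := (h.bound (show (0 : ℝ) < 2⁻¹ ^ c' / 2 by positivity))
  filter_upwards [tendsto_natCast_atTop_atTop.eventually h2, eventually_gt_atTop 0] with M hM hM0
  have hMpos : (0 : ℝ) < M := by exact_mod_cast hM0
  rw [Real.mul_rpow (by norm_num) hMpos.le]
  have h3 := (le_abs_self _).trans hM
  rw [Real.norm_of_nonneg (by positivity)] at h3
  rw [div_eq_mul_inv (M : ℝ), Real.mul_rpow hMpos.le (by norm_num)]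
  have : 0 < (2⁻¹ : ℝ) ^ c' * (M : ℝ) ^ c' := by positivity
  linarith

/-- The Hankel determinants of a sequence of small height eventually vanish, if for almost all
places the sequence is periodic modulo the place with small period. -/
theorem hankel_det_eventually_eq_zero {a : ℕ → K} {r : ℕ} (hr : 1 ≤ r)
    {S : Finset (FinitePlace K)}
    (hS : ∀ v ∉ S, (∀ n, v (a n) ≤ 1) ∧ ∃ t k : ℕ, 0 < k ∧ t + k ≤ placeNorm v ^ r ∧
      ∀ n, t ≤ n → v (a (n + k) - a n) ≤ (placeNorm v : ℝ)⁻¹)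
    {C c : ℝ} (hC : 0 ≤ C) (hc : 0 < c) (hcr : c < 1 / r)
    (hinf : ∀ (w : InfinitePlace K) (n : ℕ), w (a n) ≤ Real.exp (C * (n + 1 : ℝ) ^ c))
    (hfin : ∀ (v : FinitePlace K) (n : ℕ), v (a n) ≤ Real.exp (C * (n + 1 : ℝ) ^ c)) :
    ∃ M₀, ∀ M, M₀ ≤ M → (hankel a M).det = 0 := by
  classical
  obtain ⟨c', hcc', hc'r⟩ := exists_between hcr
  have hr0 : (0 : ℝ) < r := by exact_mod_cast hr
  -- With `ε = 1 - r * c'`, the count `x ^ (1 - ε)` at `x = (M / 2) ^ (1 / r)` equals `(M / 2) ^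
  -- c'`.
  have hε : 0 < 1 - r * c' := by
    rw [lt_div_iff₀ hr0] at hc'r; linarith
  have h1 := eventually_exists_finset_heightOneSpectrum K hε
  have h2 : Tendsto (fun M : ℕ => ((M : ℝ) / 2) ^ (1 / (r : ℝ))) atTop atTop :=
    (tendsto_rpow_atTop (by positivity)).comp
      (tendsto_natCast_atTop_atTop.atTop_div_const (by norm_num))
  have h3 := eventually_log_add_rpow_lt (A := 2 * ((Module.finrank ℚ K : ℝ) + S.card) / Real.log 2)
    (C := C) (E := S.card) hc hcc'
  obtain ⟨M₀, hM₀⟩ := ((h2.eventually h1).and (h3.and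
    (eventually_gt_atTop 0))).exists_forall_of_atTop
  refine ⟨M₀, fun M hM => ?_⟩
  obtain ⟨⟨s, hs1, hs2⟩, h4, hM0⟩ := hM₀ M hM
  by_contra hdet
  have hMpos : (0 : ℝ) < M := by exact_mod_cast hM0
  have hM2 : (0 : ℝ) ≤ (M : ℝ) / 2 := by positivity
  set s' : Finset (FinitePlace K) := s.image FinitePlace.mk
  have hcard : s'.card = s.card :=
    Finset.card_image_of_injective _ fun v w h => FinitePlace.mk_eq_iff.mp h
  have hs' : ∀ v ∈ s', placeNorm v ^ r ≤ M / 2 := by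
    intro v hv
    obtain ⟨p, hp, rfl⟩ := Finset.mem_image.mp hv
    rw [placeNorm, FinitePlace.maximalIdeal_mk, Nat.le_div_iff_mul_le (by norm_num)]
    have h5 : ((p.asIdeal.absNorm : ℝ)) ^ r ≤ M / 2 := by
      calc ((p.asIdeal.absNorm : ℝ)) ^ r ≤ (((M : ℝ) / 2) ^ (1 / (r : ℝ))) ^ r := by
            gcongr; exact hs1 p hp
        _ = _ := by
            rw [← Real.rpow_natCast, ← Real.rpow_mul hM2, one_div,
              inv_mul_cancel₀ hr0.ne', Real.rpow_one]
    rw [le_div_iff₀ (by norm_num)] at h5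
    exact_mod_cast h5
  have h6 := card_mul_le_of_hankel_det_ne_zero hS hC hc.le hinf hfin hM0 hdet hs'
  have h7 : ((M : ℝ) / 2) ^ c' ≤ s'.card := by
    rw [hcard]
    refine le_trans (le_of_eq ?_) hs2
    rw [← Real.rpow_mul hM2]
    congr 1
    field_simp
    ring
  have hlog2 : 0 < Real.log 2 := Real.log_pos (by norm_num)
  have h8 := h4.trans_le h7
  have h9 : 2 * ((Module.finrank ℚ K : ℝ) + S.card) * (Real.log M + C * (2 * M : ℝ) ^ c) <
      ((s'.card : ℝ) - S.card) * Real.log 2 := by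
    have h10 : 2 * ((Module.finrank ℚ K : ℝ) + S.card) / Real.log 2 *
        (Real.log M + C * (2 * M : ℝ) ^ c) < (s'.card : ℝ) - S.card := by linarith
    rwa [div_mul_eq_mul_div, div_lt_iff₀ hlog2] at h10
  nlinarith

end HankelVanishing

/-! ### A size of algebraic numbers that does not depend on a number field. -/

section AlgebraicNumberSize

open OrbitGrowth

/-- All the conjugates of an algebraic number, and some denominator of it, are at most `B`. -/
def SizeLE (B : ℝ) (x : QBar) : Prop :=
  (∀ σ : QBar →+* ℂ, ‖σ x‖ ≤ B) ∧ ∃ d : ℕ, d ≠ 0 ∧ (d : ℝ) ≤ B ∧ IsIntegral ℤ ((d : QBar) * x)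

theorem SizeLE.one_le {B : ℝ} {x : QBar} (h : SizeLE B x) : 1 ≤ B := by
  obtain ⟨-, d, hd, hdB, -⟩ := h
  exact le_trans (by exact_mod_cast Nat.one_le_iff_ne_zero.mpr hd) hdB

theorem SizeLE.mono {B B' : ℝ} {x : QBar} (h : SizeLE B x) (hB : B ≤ B') : SizeLE B' x :=
  ⟨fun σ => (h.1 σ).trans hB, h.2.imp fun _ hd => ⟨hd.1, hd.2.1.trans hB, hd.2.2⟩⟩

theorem SizeLE.mul {B B' : ℝ} {x y : QBar} (hx : SizeLE B x) (hy : SizeLE B' y) :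
    SizeLE (B * B') (x * y) := by
  have h1 := hx.one_le
  have h2 := hy.one_le
  obtain ⟨hx1, d, hd, hdB, hdi⟩ := hx
  obtain ⟨hy1, e, he, heB, hei⟩ := hy
  refine ⟨fun σ => ?_, d * e, mul_ne_zero hd he, ?_, ?_⟩
  · rw [map_mul, norm_mul]
    exact mul_le_mul (hx1 σ) (hy1 σ) (norm_nonneg _) (by linarith)
  · push_cast
    exact mul_le_mul hdB heB (by positivity) (by linarith)
  · have : ((d * e : ℕ) : QBar) * (x * y) = (d * x) * (e * y) := by push_cast; ring
    rw [this]
    exact hdi.mul hei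

theorem SizeLE.add {B B' : ℝ} {x y : QBar} (hx : SizeLE B x) (hy : SizeLE B' y) :
    SizeLE (2 * (B * B')) (x + y) := by
  have h1 := hx.one_le
  have h2 := hy.one_le
  obtain ⟨hx1, d, hd, hdB, hdi⟩ := hx
  obtain ⟨hy1, e, he, heB, hei⟩ := hy
  have h3 : (d : ℝ) * e ≤ B * B' := mul_le_mul hdB heB (by positivity) (by linarith)
  refine ⟨fun σ => ?_, d * e, mul_ne_zero hd he, ?_, ?_⟩
  · rw [map_add]
    refine (norm_add_le _ _).trans ((add_le_add (hx1 σ) (hy1 σ)).trans ?_)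
    nlinarith
  · push_cast
    nlinarith
  · have : ((d * e : ℕ) : QBar) * (x + y) = e * (d * x) + d * (e * y) := by push_cast; ring
    rw [this]
    have hn : ∀ n : ℕ, IsIntegral ℤ (n : QBar) := fun n => by
      exact_mod_cast isIntegral_algebraMap (R := ℤ) (A := QBar) (x := n)
    exact ((hn e).mul hdi).add ((hn d).mul hei)

theorem sizeLE_zero : SizeLE 1 0 :=
  ⟨fun σ => by simp, 1, one_ne_zero, by simp, by simpa using isIntegral_zero⟩

theorem SizeLE.sum {B : ℕ → ℝ} {x : ℕ → QBar} (h : ∀ k, SizeLE (B k) (x k)) (m : ℕ) :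
    SizeLE (2 ^ m * ∏ k ∈ Finset.range m, B k) (∑ k ∈ Finset.range m, x k) := by
  induction m with
  | zero => simpa using sizeLE_zero
  | succ m ih =>
    rw [Finset.sum_range_succ, Finset.prod_range_succ]
    refine (ih.add (h m)).mono (le_of_eq ?_)
    ring

theorem infinitePlace_le_mulHeight₁ {L : Type*} [Field L] [NumberField L] (w : InfinitePlace L)
    (x : L) : w x ≤ Height.mulHeight₁ x := by
  classical
  rw [mulHeight₁_eq]
  have h1 : ∀ v : InfinitePlace L, 1 ≤ max (v x) 1 ^ v.mult := fun v =>
    one_le_pow₀ (le_max_right _ _)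
  have h2 : max (w x) 1 ≤ ∏ v : InfinitePlace L, max (v x) 1 ^ v.mult := by
    rw [← Finset.mul_prod_erase _ _ (Finset.mem_univ w)]
    have h3 : max (w x) 1 ≤ max (w x) 1 ^ w.mult := le_self_pow₀ (le_max_right _ _) w.mult_ne_zero
    have h4 : 1 ≤ ∏ v ∈ Finset.univ.erase w, max (v x) 1 ^ v.mult :=
      Finset.prod_induction (fun v : InfinitePlace L => max (v x) 1 ^ v.mult) (fun z : ℝ => 1 ≤ z)
        (fun a b => one_le_mul_of_one_le_of_one_le) le_rfl fun v _ => h1 v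
    nlinarith [h1 w]
  have h5 : 1 ≤ ∏ᶠ v : FinitePlace L, max (v x) 1 := one_le_finprod fun v => le_max_right _ _
  have h6 := le_max_left (w x) 1
  have h7 := le_max_right (w x) 1
  nlinarith

theorem sizeLE_algebraMap_mulHeight₁ {L : Type*} [Field L] [NumberField L] [Algebra L QBar] (x : L) :
    SizeLE (Height.mulHeight₁ x) (algebraMap L QBar x) := by
  refine ⟨fun σ => ?_, ?_⟩
  · have := infinitePlace_le_mulHeight₁ (InfinitePlace.mk (σ.comp (algebraMap L QBar))) x
    simpa using this
  · obtain ⟨d, hd, hdB, hdi⟩ := exists_nat_le_mulHeight₁ x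
    refine ⟨d, hd, hdB, ?_⟩
    have := hdi.map (algebraMap L QBar).toIntAlgHom
    simpa using this

/-- The height of one coordinate is at most that of the point. The factor `D` turns the absolute
height into a bound for the relative one. -/
theorem sizeLE_of_affineHeight {r : ℕ} {x : Fin r → QBar} {D : ℝ}
    (hD : (Module.finrank ℚ (coordinateField x) : ℝ) ≤ D) (j : Fin r) :
    SizeLE (Real.exp (D * affineHeight x)) (x j) := by
  let y : coordinateField x := homogeneousCoordinates x j.succ
  have hy : algebraMap (coordinateField x) QBar y = x j := by
    simp [y, homogeneousCoordinates]
  rw [← hy]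
  refine (sizeLE_algebraMap_mulHeight₁ y).mono ?_
  have h1 : ![y, 1] = homogeneousCoordinates x ∘ ![j.succ, 0] := by
    ext i
    fin_cases i <;> simp [y, homogeneousCoordinates]
  have h2 : Height.mulHeight₁ y ≤ Height.mulHeight (homogeneousCoordinates x) := by
    rw [Height.mulHeight₁_eq_mulHeight, h1]
    exact Height.mulHeight_comp_le _ _
  have hpos : (0 : ℝ) < Module.finrank ℚ (coordinateField x) := by
    exact_mod_cast Module.finrank_pos
  refine h2.trans ?_
  rw [← Real.exp_log (Height.mulHeight_pos (homogeneousCoordinates x)),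
    ← Height.logHeight_eq_log_mulHeight]
  apply Real.exp_le_exp.mpr
  have h3 := Height.logHeight_nonneg (homogeneousCoordinates x)
  rw [affineHeight, ← mul_div_assoc, le_div_iff₀ hpos, mul_comm]
  gcongr

theorem exists_sizeLE (x : QBar) : ∃ B, SizeLE B x :=
  ⟨_, sizeLE_of_affineHeight (x := fun _ : Fin 1 => x) le_rfl 0⟩

/-- Every complex embedding of `L` extends to `QBar`, which is algebraic over `L`. -/
theorem infinitePlace_le_of_sizeLE {L : Type*} [Field L] [Algebra L QBar] {B : ℝ} {x : L}
    [Algebra.IsAlgebraic L QBar]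
    (h : SizeLE B (algebraMap L QBar x)) (w : InfinitePlace L) : w x ≤ B := by
  let : Algebra L ℂ := w.embedding.toAlgebra
  let σ : QBar →ₐ[L] ℂ := IsAlgClosed.lift
  have h1 := h.1 σ.toRingHom
  have h2 : σ.toRingHom (algebraMap L QBar x) = w.embedding x := σ.commutes x
  rwa [h2, InfinitePlace.norm_embedding_eq] at h1

/-- If `d * x` is integral, then `v x` is at most the inverse of `v d`. This inverse is the norm of
an ideal that divides `(d)`, hence at most `d ^ [L : ℚ]`. -/
theorem finitePlace_le_of_sizeLE {L : Type*} [Field L] [NumberField L] [Algebra L QBar] {B : ℝ}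
    {x : L} (h : SizeLE B (algebraMap L QBar x)) (v : FinitePlace L) :
    v x ≤ B ^ Module.finrank ℚ L := by
  obtain ⟨-, d, hd, hdB, hdi⟩ := h
  have hint : IsIntegral ℤ ((d : L) * x) := by
    refine (isIntegral_algHom_iff (algebraMap L QBar).toIntAlgHom
      (algebraMap L QBar).injective).mp ?_
    have h1 : (algebraMap L QBar).toIntAlgHom ((d : L) * x) = (d : QBar) * algebraMap L QBar x := by
      simp
    rw [h1]
    convert hdi
    exact Subsingleton.elim _ _
  obtain ⟨y, hy⟩ : ∃ y : 𝓞 L, algebraMap (𝓞 L) L y = (d : L) * x := ⟨⟨_, hint⟩, rfl⟩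
  have h1 := finitePlace_integer_le_one v y
  have hd0 : ((d : ℕ) : 𝓞 L) ≠ 0 := by exact_mod_cast hd
  have h2 := FinitePlace.apply_mul_absNorm_pow_eq_one v hd0
  set m := multiplicity v.maximalIdeal.asIdeal (Ideal.span {((d : ℕ) : 𝓞 L)})
  have h3 : v.maximalIdeal.asIdeal.absNorm ^ m ≤ d ^ Module.finrank ℚ L := by
    rw [← map_pow, ← RingOfIntegers.rank, ← Ideal.absNorm_span_natCast]
    apply Nat.le_of_dvd
    · rw [Ideal.absNorm_span_natCast]
      exact pow_pos (Nat.pos_of_ne_zero hd) _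
    · exact map_dvd _ (pow_multiplicity_dvd _ _)
  have h4 : v (algebraMap (𝓞 L) L y) = v (d : L) * v x := by rw [hy, map_mul]
  have h5 : v (((d : ℕ) : 𝓞 L) : L) = v (d : L) := by
    congr 1
  have h1' : v (d : L) * v x ≤ 1 := h4 ▸ h1
  rw [h5] at h2
  set N : ℝ := (v.maximalIdeal.asIdeal.absNorm : ℝ) ^ m
  have hN : N ≤ B ^ Module.finrank ℚ L := by
    calc N ≤ (d : ℝ) ^ Module.finrank ℚ L := by simp only [N]; exact_mod_cast h3
      _ ≤ _ := by gcongr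
  have hN0 : 0 ≤ N := by positivity
  calc v x = N * (v (d : L) * v x) := by rw [← mul_assoc, mul_comm N, h2, one_mul]
    _ ≤ N * 1 := by gcongr
    _ ≤ _ := by rwa [mul_one]

end AlgebraicNumberSize

/-! ### Characteristic roots of recurrences of small size. -/

section RootsOfUnity

open OrbitGrowth

theorem le_one_of_pow_le_exp_rpow {ρ A C c : ℝ} {D : ℕ} (hA : 0 < A) (hc : c < 1)
    (h : ∀ n : ℕ, ρ ^ n ≤ (A * Real.exp (C * (n + 1 : ℝ) ^ c)) ^ D) : ρ ≤ 1 := by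
  by_contra! hρ1
  have hlog : 0 < Real.log ρ := Real.log_pos hρ1
  have h1 : (fun t : ℝ => (D * C) * t ^ c + (D * Real.log A + Real.log ρ)) =o[atTop]
      fun t : ℝ => t ^ (1 : ℝ) :=
    ((isLittleO_rpow_rpow_atTop hc).const_mul_left _).add
      (Asymptotics.isLittleO_const_left.mpr (Or.inr
        (tendsto_norm_atTop_atTop.comp (tendsto_rpow_atTop one_pos))))
  have h2 := h1.bound (show 0 < Real.log ρ / 2 by positivity)
  obtain ⟨n, hn⟩ := ((tendsto_atTop_add_const_right atTop (1 : ℝ)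
    tendsto_natCast_atTop_atTop).eventually h2).exists
  have hn0 : (0 : ℝ) < (n : ℝ) + 1 := by positivity
  simp only [Real.rpow_one, Real.norm_eq_abs, abs_of_pos hn0] at hn
  have h3 := (le_abs_self _).trans hn
  have h4 := Real.log_le_log (by positivity) (h n)
  rw [Real.log_pow, Real.log_pow, Real.log_mul hA.ne' (by positivity), Real.log_exp] at h4
  nlinarith

/-- Subexponential growth of the powers forces every absolute value of `ρ` to be at most `1`. So `ρ`
is an algebraic integer with all conjugates in the closed unit disc, and Kronecker's theorem
applies. -/
theorem exists_pow_eq_one_of_sizeLE_pow {ρ : QBar} (h0 : ρ ≠ 0) {A C c : ℝ} (hA : 0 < A)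
    (hc : c < 1) (h : ∀ n : ℕ, SizeLE (A * Real.exp (C * (n + 1 : ℝ) ^ c)) (ρ ^ n)) :
    ∃ d : ℕ, 0 < d ∧ ρ ^ d = 1 := by
  let L := coordinateField (fun _ : Fin 1 => ρ)
  let y : L := ⟨ρ, IntermediateField.subset_adjoin ℚ _ (Set.mem_range_self 0)⟩
  have hy : algebraMap L QBar y = ρ := rfl
  have hy0 : y ≠ 0 := by
    intro h'
    exact h0 (by rw [← hy, h', map_zero])
  have hpow : ∀ n : ℕ, SizeLE (A * Real.exp (C * (n + 1 : ℝ) ^ c)) (algebraMap L QBar (y ^ n)) :=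
    fun n => by rw [map_pow, hy]; exact h n
  have hinf : ∀ φ : L →+* ℂ, ‖φ y‖ ≤ 1 := by
    intro φ
    refine le_one_of_pow_le_exp_rpow (D := 1) (C := C) hA hc fun n => ?_
    have := infinitePlace_le_of_sizeLE (hpow n) (InfinitePlace.mk φ)
    rw [map_pow, InfinitePlace.apply] at this
    rwa [pow_one]
  have hfin : ∀ v : FinitePlace L, v y ≤ 1 := by
    intro v
    refine le_one_of_pow_le_exp_rpow (D := Module.finrank ℚ L) (C := C) hA hc fun n => ?_
    have := finitePlace_le_of_sizeLE (hpow n) v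
    rwa [map_pow] at this
  have hint : IsIntegral ℤ y := by
    obtain ⟨z, hz⟩ := IsDedekindDomain.HeightOneSpectrum.mem_integers_of_valuation_le_one
      (R := 𝓞 L) L y fun v => by
        have h1 := hfin (FinitePlace.mk v)
        rw [FinitePlace.mk_apply, FinitePlace.norm_embedding'] at h1
        exact (WithZeroMulInt.toNNReal_le_one_iff (HeightOneSpectrum.one_lt_absNorm_nnreal v)).mp
          (by exact_mod_cast h1)
    rw [← hz]
    exact z.isIntegral_coe
  obtain ⟨d, hd, hd1⟩ := Embeddings.pow_eq_one_of_norm_le_one L ℂ hy0 hint hinf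
  refine ⟨d, hd, ?_⟩
  rw [← hy, ← map_pow, hd1, map_one]

open Polynomial

/-- A characteristic root of a minimal recurrence of a sequence of small size is zero or a root
of unity. -/
theorem exists_pow_eq_one_of_isRoot {a : ℕ → QBar} {C c : ℝ} (hC : 0 ≤ C) (hc0 : 0 ≤ c)
    (hc : c < 1)
    (ha : ∀ n : ℕ, SizeLE (Real.exp (C * (n + 1 : ℝ) ^ c)) (a n)) {q : QBar[X]} (hq0 : q ≠ 0)
    (hq : aeval (seqShift QBar) q a = 0)
    (hmin : ∀ g : QBar[X], g ≠ 0 → aeval (seqShift QBar) g a = 0 → q.natDegree ≤ g.natDegree)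
    {ρ : QBar} (hρ : q.IsRoot ρ) (h0 : ρ ≠ 0) : ∃ d : ℕ, 0 < d ∧ ρ ^ d = 1 := by
  obtain ⟨g, rfl⟩ := dvd_iff_isRoot.mpr hρ
  have hg0 : g ≠ 0 := right_ne_zero_of_mul hq0
  -- By minimality of `q = (X - ρ) * g`, the sequence `b` is nonzero, while `X - ρ` annihilates it.
  -- So it is geometric with ratio `ρ`.
  set b := aeval (seqShift QBar) g a with hb
  have hbne : b ≠ 0 := by
    intro h
    have := hmin g hg0 h
    rw [natDegree_mul (X_sub_C_ne_zero ρ) hg0, natDegree_X_sub_C] at this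
    omega
  have hbrec : ∀ n, b (n + 1) = ρ * b n := by
    intro n
    rw [map_mul, Module.End.mul_apply, ← hb, map_sub, aeval_X, aeval_C] at hq
    have := congrFun hq n
    rw [LinearMap.sub_apply, Pi.sub_apply, Module.algebraMap_end_apply, Pi.smul_apply,
      Pi.zero_apply, sub_eq_zero, smul_eq_mul] at this
    rw [← this]
    rfl
  have hbn : ∀ n, b n = ρ ^ n * b 0 := by
    intro n
    induction n with
    | zero => simp
    | succ n ih => rw [hbrec, ih]; ring
  have hb0 : b 0 ≠ 0 := by
    intro h
    apply hbne
    ext n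
    rw [hbn, h, mul_zero, Pi.zero_apply]
  choose G hG using fun k => exists_sizeLE (g.coeff k)
  obtain ⟨B, hB⟩ := exists_sizeLE (b 0)⁻¹
  set m := g.natDegree + 1
  have hG1 : ∀ k, 1 ≤ G k := fun k => (hG k).one_le
  have hB1 := hB.one_le
  have hGpos : 0 < ∏ k ∈ Finset.range m, G k := Finset.prod_pos fun k _ => by
    linarith [hG1 k]
  refine exists_pow_eq_one_of_sizeLE_pow h0
    -- The exponent comes from a product of `m` bounds at indices `n + k`, using `n + k + 1 ≤ (m +
    -- 1) * (n + 1)`.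
    (A := 2 ^ m * (∏ k ∈ Finset.range m, G k) * B) (C := m * C * (m + 1) ^ c) (c := c)
    (by positivity) hc fun n => ?_
  have h1 : ρ ^ n = (∑ k ∈ Finset.range m, g.coeff k * a (n + k)) * (b 0)⁻¹ := by
    rw [← aeval_seqShift_apply, ← hb, hbn n, mul_assoc, mul_inv_cancel₀ hb0, mul_one]
  rw [h1]
  have h2 : SizeLE (2 ^ m * ∏ k ∈ Finset.range m,
      (G k * Real.exp (C * (((n + k : ℕ) : ℝ) + 1) ^ c)))
      (∑ k ∈ Finset.range m, g.coeff k * a (n + k)) :=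
    SizeLE.sum (fun k => (hG k).mul (ha (n + k))) m
  refine (h2.mul hB).mono ?_
  have h3 : ∏ k ∈ Finset.range m, Real.exp (C * (((n + k : ℕ) : ℝ) + 1) ^ c) ≤
      Real.exp (m * C * (m + 1) ^ c * (n + 1 : ℝ) ^ c) := by
    rw [← Real.exp_sum]
    apply Real.exp_le_exp.mpr
    refine (Finset.sum_le_card_nsmul _ _ (C * ((m + 1) ^ c * (n + 1 : ℝ) ^ c)) fun k hk => ?_).trans ?_
    · rw [← Real.mul_rpow (by positivity) (by positivity)]
      have h4 : (k : ℝ) ≤ m := by exact_mod_cast (Finset.mem_range.mp hk).le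
      push_cast
      gcongr
      nlinarith [Nat.cast_nonneg (α := ℝ) n, Nat.cast_nonneg (α := ℝ) m]
    · rw [Finset.card_range, nsmul_eq_mul]
      apply le_of_eq; ring
  rw [Finset.prod_mul_distrib]
  calc _ ≤ 2 ^ m * ((∏ k ∈ Finset.range m, G k) *
        Real.exp (m * C * (m + 1) ^ c * (n + 1 : ℝ) ^ c)) * B := by gcongr
    _ = _ := by ring

end RootsOfUnity

/-! ### From recurrences to polynomials along residue classes. -/

section EventuallyPolynomial

open Polynomial

/-- A sequence that is eventually polynomial on each residue class modulo `d`. -/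
def EventuallyPolynomialMod {F : Type*} [CommRing F] (a : ℕ → F) (d : ℕ) : Prop :=
  ∀ i : ℕ, ∃ (N : ℕ) (p : F[X]), ∀ n : ℕ, N ≤ n → a (n * d + i) = p.eval (n : F)

theorem EventuallyPolynomialMod.of_dvd {F : Type*} [CommRing F] {a : ℕ → F} {d e : ℕ}
    (h : EventuallyPolynomialMod a d) (hde : d ∣ e) (he : e ≠ 0) : EventuallyPolynomialMod a e := by
  obtain ⟨k, rfl⟩ := hde
  intro i
  obtain ⟨N, p, hp⟩ := h i
  refine ⟨N, p.comp (C (k : F) * X), fun n hn => ?_⟩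
  have hk : k ≠ 0 := right_ne_zero_of_mul he
  have h1 := hp (n * k) (hn.trans (Nat.le_mul_of_pos_right _ (Nat.pos_of_ne_zero hk)))
  rw [eval_comp, eval_mul, eval_C, eval_X, show n * (d * k) + i = n * k * d + i by ring, h1]
  push_cast
  rw [mul_comm (n : F)]

/-- Newton's forward difference formula stops at order `e`; characteristic zero allows division by
the factorials. -/
theorem exists_polynomial_of_fwdDiff_iter_eq_zero {F : Type*} [Field F] [CharZero F] {b : ℕ → F}
    {e : ℕ} (h : (fwdDiff (1 : ℕ))^[e] b = 0) :
    ∃ p : F[X], ∀ n : ℕ, b n = p.eval (n : F) := by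
  refine ⟨∑ k ∈ Finset.range e, C ((fwdDiff (1 : ℕ))^[k] b 0 / k.factorial) * descPochhammer F k,
    fun n => ?_⟩
  have h1 := shift_eq_sum_fwdDiff_iter (1 : ℕ) b n 0
  have h2 : ∀ k, e ≤ k → (fwdDiff (1 : ℕ))^[k] b = 0 := by
    intro k hk
    obtain ⟨l, rfl⟩ := Nat.exists_eq_add_of_le hk
    rw [add_comm, Function.iterate_add_apply, h]
    induction l with
    | zero => rfl
    | succ l ih =>
      rw [Function.iterate_succ_apply', ih (by omega)]
      ext; simp [fwdDiff]
  simp only [zero_add, smul_eq_mul, mul_one] at h1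
  rw [h1, eval_finsetSum]
  have h3 : ∀ k, (C ((fwdDiff (1 : ℕ))^[k] b 0 / k.factorial) * descPochhammer F k).eval (n : F) =
      n.choose k • (fwdDiff (1 : ℕ))^[k] b 0 := by
    intro k
    rw [eval_mul, eval_C, descPochhammer_eval_eq_descFactorial, nsmul_eq_mul,
      Nat.descFactorial_eq_factorial_mul_choose]
    have : (k.factorial : F) ≠ 0 := by exact_mod_cast k.factorial_ne_zero
    push_cast
    field_simp
  simp_rw [h3]
  rcases le_total e (n + 1) with hle | hle
  · symm
    refine Finset.sum_subset (Finset.range_mono hle) fun k _ hk => ?_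
    rw [h2 k (by simpa using hk), Pi.zero_apply, smul_zero]
  · refine Finset.sum_subset (Finset.range_mono hle) fun k _ hk => ?_
    rw [Nat.choose_eq_zero_of_lt (by simp at hk; omega), zero_smul]

theorem fwdDiff_iter_comp_residue {F : Type*} [CommRing F] (d i e : ℕ) (a : ℕ → F) (n : ℕ) :
    (fwdDiff (1 : ℕ))^[e] (fun n => a (n * d + i)) n =
      ((seqShift F ^ d - 1) ^ e) a (n * d + i) := by
  induction e generalizing n with
  | zero => simp
  | succ e ih =>
    rw [Function.iterate_succ_apply', fwdDiff, ih, ih, pow_succ', Module.End.mul_apply,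
      LinearMap.sub_apply, Pi.sub_apply, seqShift_pow_apply, Module.End.one_apply,
      show (n + 1) * d + i = n * d + i + d by ring]

/-- The factor `X ^ e` only delays the recurrence `(X ^ d - 1) ^ e` to indices at least `e`. On a
residue class modulo `d`, `X ^ d - 1` acts as the forward difference. -/
theorem eventuallyPolynomialMod_of_recurrence {F : Type*} [Field F] [CharZero F] {a : ℕ → F}
    {d e : ℕ} (hd : 0 < d) (h : aeval (seqShift F) (((X : F[X]) * (X ^ d - 1)) ^ e) a = 0) :
    EventuallyPolynomialMod a d := by
  have h1 : ∀ n, e ≤ n → ((seqShift F ^ d - 1) ^ e) a n = 0 := by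
    intro n hn
    rw [mul_pow, map_mul, Module.End.mul_apply, map_pow, map_pow, map_sub, map_pow, aeval_X,
      map_one] at h
    have := congrFun h (n - e)
    rwa [seqShift_pow_apply, Nat.sub_add_cancel hn] at this
  intro i
  obtain ⟨p, hp⟩ := exists_polynomial_of_fwdDiff_iter_eq_zero (e := e)
    (b := fun n => a (n * d + (e * d + i))) (by
      ext n
      rw [fwdDiff_iter_comp_residue, h1 _ (by nlinarith), Pi.zero_apply])
  refine ⟨e, p.comp (X - C (e : F)), fun n hn => ?_⟩
  have h2 := hp (n - e)
  rw [show (n - e) * d + (e * d + i) = n * d + i by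
    rw [← add_assoc, ← add_mul, Nat.sub_add_cancel hn]] at h2
  rw [h2, eval_comp, eval_sub, eval_X, eval_C, Nat.cast_sub hn]

end EventuallyPolynomial

/-! ### Recurrence sequences of small size. -/

section SmallRecurrences

open OrbitGrowth Polynomial

/-- A linear recurrence sequence of algebraic numbers of small size is eventually polynomial along
residue classes. -/
theorem exists_eventuallyPolynomialMod_of_sizeLE {a : ℕ → QBar} {A c : ℝ} (hA : 0 ≤ A)
    (hc0 : 0 ≤ c) (hc : c < 1)
    (ha : ∀ n : ℕ, SizeLE (Real.exp (A * (n + 1 : ℝ) ^ c)) (a n))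
    (h : ∃ q : QBar[X], q ≠ 0 ∧ aeval (seqShift QBar) q a = 0) :
    ∃ d : ℕ, 0 < d ∧ EventuallyPolynomialMod a d := by
  classical
  have hex : ∃ k : ℕ, ∃ q : QBar[X], q.natDegree = k ∧ q ≠ 0 ∧ aeval (seqShift QBar) q a = 0 := by
    obtain ⟨q, h1, h2⟩ := h
    exact ⟨_, q, rfl, h1, h2⟩
  obtain ⟨q, hqd, hq0, hq⟩ := Nat.find_spec hex
  have hmin : ∀ g : QBar[X], g ≠ 0 → aeval (seqShift QBar) g a = 0 →
      q.natDegree ≤ g.natDegree := fun g h1 h2 => by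
    rw [hqd]
    exact Nat.find_min' hex ⟨g, rfl, h1, h2⟩
  have hroot : ∀ ρ : QBar, ∃ d : ℕ, 0 < d ∧ (ρ ∈ q.roots → ρ = 0 ∨ ρ ^ d = 1) := by
    intro ρ
    by_cases hρ : ρ ∈ q.roots
    · by_cases h0 : ρ = 0
      · exact ⟨1, one_pos, fun _ => Or.inl h0⟩
      · obtain ⟨d, hd, hd1⟩ := exists_pow_eq_one_of_isRoot hA hc0 hc ha hq0 hq hmin
          (isRoot_of_mem_roots hρ) h0
        exact ⟨d, hd, fun _ => Or.inr hd1⟩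
    · exact ⟨1, one_pos, fun h => absurd h hρ⟩
  choose o ho1 ho2 using hroot
  set d := ∏ ρ ∈ q.roots.toFinset, o ρ
  have hd : 0 < d := Finset.prod_pos fun ρ _ => ho1 ρ
  refine ⟨d, hd, eventuallyPolynomialMod_of_recurrence (e := q.natDegree) hd ?_⟩
  -- Each of the `q.natDegree` linear factors of `q`, counted with multiplicity, divides `X * (X ^ d
  -- - 1)`.
  have hdvd : q ∣ (X * (X ^ d - 1)) ^ q.natDegree := by
    have hsplit := IsAlgClosed.splits q
    have h1 : (q.roots.map fun ρ => (X - C ρ : QBar[X])).prod ∣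
        (q.roots.map fun _ => (X * (X ^ d - 1) : QBar[X])).prod := by
      refine Multiset.prod_dvd_prod_of_dvd _ _ fun ρ hρ => ?_
      rw [dvd_iff_isRoot, IsRoot, eval_mul, eval_X, eval_sub, eval_pow, eval_X, eval_one]
      rcases ho2 ρ hρ with h2 | h2
      · rw [h2, zero_mul]
      · obtain ⟨k, hk⟩ : o ρ ∣ d := Finset.dvd_prod_of_mem _ (Multiset.mem_toFinset.mpr hρ)
        rw [hk, pow_mul, h2, one_pow, sub_self, mul_zero]
    rw [Multiset.map_const', Multiset.prod_replicate, ← hsplit.natDegree_eq_card_roots] at h1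
    have hlc : IsUnit (C q.leadingCoeff) := isUnit_C.mpr (isUnit_iff_ne_zero.mpr
      (leadingCoeff_ne_zero.mpr hq0))
    conv_lhs => rw [hsplit.eq_prod_roots]
    exact hlc.mul_left_dvd.mpr h1
  obtain ⟨g, hg⟩ := hdvd
  rw [hg, mul_comm, map_mul, Module.End.mul_apply, hq, map_zero]

end SmallRecurrences

/-! ### Zariski closures and polynomially parametrized curves. -/

section ZariskiClosure

open OrbitGrowth

variable {r : ℕ}

theorem subset_zariskiClosure (S : Set (Fin r → QBar)) : S ⊆ zariskiClosure S :=
  MvPolynomial.zeroLocus_vanishingIdeal_le S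

theorem zariskiClosure_mono {S T : Set (Fin r → QBar)} (h : S ⊆ T) :
    zariskiClosure S ⊆ zariskiClosure T :=
  MvPolynomial.zeroLocus_anti_mono (MvPolynomial.vanishingIdeal_anti_mono h)

theorem vanishingIdeal_zariskiClosure (S : Set (Fin r → QBar)) :
    MvPolynomial.vanishingIdeal QBar (zariskiClosure S) = MvPolynomial.vanishingIdeal QBar S :=
  le_antisymm (MvPolynomial.vanishingIdeal_anti_mono (subset_zariskiClosure S))
    (MvPolynomial.le_vanishingIdeal_zeroLocus _)

theorem zariskiClosure_zariskiClosure (S : Set (Fin r → QBar)) :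
    zariskiClosure (zariskiClosure S) = zariskiClosure S :=
  congrArg (MvPolynomial.zeroLocus QBar) (vanishingIdeal_zariskiClosure S)

theorem zariskiClosure_union (S T : Set (Fin r → QBar)) :
    zariskiClosure (S ∪ T) = zariskiClosure S ∪ zariskiClosure T := by
  apply subset_antisymm
  · intro x hx
    by_contra hcon
    rw [Set.mem_union, not_or] at hcon
    simp only [zariskiClosure, MvPolynomial.mem_zeroLocus_iff, not_forall] at hcon
    obtain ⟨⟨f, hf, hfx⟩, g, hg, hgx⟩ := hcon
    have h : f * g ∈ MvPolynomial.vanishingIdeal QBar (S ∪ T) := by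
      rintro y (hy | hy)
      · rw [map_mul, hf y hy, zero_mul]
      · rw [map_mul, hg y hy, mul_zero]
    have := hx _ h
    rw [map_mul] at this
    exact (mul_ne_zero hfx hgx) this
  · exact Set.union_subset (zariskiClosure_mono Set.subset_union_left)
      (zariskiClosure_mono Set.subset_union_right)

theorem zariskiClosure_empty : zariskiClosure (∅ : Set (Fin r → QBar)) = ∅ := by
  rw [zariskiClosure, MvPolynomial.vanishingIdeal_empty, MvPolynomial.zeroLocus_top]
  rfl

theorem zariskiClosure_singleton (x : Fin r → QBar) : zariskiClosure {x} = {x} := by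
  apply subset_antisymm _ (subset_zariskiClosure _)
  intro y hy
  ext i
  have h := hy (MvPolynomial.X i - MvPolynomial.C (x i)) (by
    rintro _ rfl
    simp)
  simpa [sub_eq_zero] using h

theorem zariskiClosure_biUnion {ι : Type*} (s : Finset ι) (S : ι → Set (Fin r → QBar)) :
    zariskiClosure (⋃ i ∈ s, S i) = ⋃ i ∈ s, zariskiClosure (S i) := by
  classical
  induction s using Finset.induction_on with
  | empty => simpa using zariskiClosure_empty
  | insert i s hi ih =>
    rw [Finset.set_biUnion_insert, zariskiClosure_union, ih, Finset.set_biUnion_insert]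

theorem zariskiClosure_of_finite {S : Set (Fin r → QBar)} (hS : S.Finite) :
    zariskiClosure S = S := by
  have h : S = ⋃ x ∈ hS.toFinset, {x} := by ext; simp
  conv_lhs => rw [h, zariskiClosure_biUnion]
  conv_rhs => rw [h]
  simp_rw [zariskiClosure_singleton]

open Polynomial

/-- The points of a polynomially parametrized curve with integer parameters at least `N`. -/
def integerPoints (p : Fin r → QBar[X]) (N : ℕ) : Set (Fin r → QBar) :=
  {x | ∃ n : ℕ, N ≤ n ∧ ∀ j, x j = (p j).eval (n : QBar)}

theorem eval_aeval_polynomial (p : Fin r → QBar[X]) (f : MvPolynomial (Fin r) QBar) (t : QBar) :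
    (MvPolynomial.aeval p f).eval t = MvPolynomial.aeval (fun j => (p j).eval t) f := by
  induction f using MvPolynomial.induction_on with
  | C a => simp
  | add f g hf hg => simp [hf, hg]
  | mul_X f i hf => simp [hf]

/-- A polynomial in the parameter that vanishes at all integers `n ≥ N` is zero. So the ideal is
independent of `N`, and it is prime as the kernel of a map to a domain. -/
theorem vanishingIdeal_integerPoints (p : Fin r → QBar[X]) (N : ℕ) :
    MvPolynomial.vanishingIdeal QBar (integerPoints p N) =
      RingHom.ker (MvPolynomial.aeval p : MvPolynomial (Fin r) QBar →ₐ[QBar] QBar[X]) := by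
  ext f
  rw [MvPolynomial.mem_vanishingIdeal_iff, RingHom.mem_ker]
  constructor
  · intro h
    refine eq_zero_of_infinite_isRoot _ (Set.Infinite.mono (s := Nat.cast '' Set.Ici N) ?_
      ((Set.Ici_infinite N).image Nat.cast_injective.injOn))
    rintro _ ⟨n, hn, rfl⟩
    rw [Set.mem_ofPred_eq, IsRoot, eval_aeval_polynomial]
    exact h _ ⟨n, hn, fun j => rfl⟩
  · rintro h x ⟨n, hn, hx⟩
    rw [show x = fun j => (p j).eval (n : QBar) from funext hx, ← eval_aeval_polynomial, h,
      eval_zero]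

/-- The Zariski closure of the integer points of a nonconstant polynomially parametrized curve is a
rational curve, by Lüroth's theorem. -/
theorem isRationalCurve_zariskiClosure_integerPoints {p : Fin r → QBar[X]}
    (hp : ∃ j, (p j).natDegree ≠ 0) (N : ℕ) :
    IsRationalCurve (zariskiClosure (integerPoints p N)) := by
  have hI : MvPolynomial.vanishingIdeal QBar (zariskiClosure (integerPoints p N)) =
      RingHom.ker (MvPolynomial.aeval p : MvPolynomial (Fin r) QBar →ₐ[QBar] QBar[X]) := by
    rw [vanishingIdeal_zariskiClosure, vanishingIdeal_integerPoints]
  have hprime : (MvPolynomial.vanishingIdeal QBar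
      (zariskiClosure (integerPoints p N))).IsPrime := by
    rw [hI]
    exact RingHom.ker_isPrime _
  refine ⟨zariskiClosure_zariskiClosure _, hprime, ?_⟩
  set I := MvPolynomial.vanishingIdeal QBar (zariskiClosure (integerPoints p N))
  let ψ : MvPolynomial (Fin r) QBar →ₐ[QBar] RatFunc QBar :=
    (IsScalarTower.toAlgHom QBar QBar[X] (RatFunc QBar)).comp (MvPolynomial.aeval p)
  have hψ : ∀ f, ψ f = algebraMap QBar[X] (RatFunc QBar) (MvPolynomial.aeval p f) := fun f => rfl
  have hψker : ∀ f, ψ f = 0 ↔ f ∈ I := by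
    intro f
    rw [hI, RingHom.mem_ker, hψ, map_eq_zero_iff _ (RatFunc.algebraMap_injective QBar)]
  let ψ' : (MvPolynomial (Fin r) QBar ⧸ I) →ₐ[QBar] RatFunc QBar :=
    Ideal.Quotient.liftₐ I ψ fun f hf => (hψker f).mpr hf
  have hinj : Function.Injective ψ' := by
    rw [injective_iff_map_eq_zero]
    intro a ha
    obtain ⟨f, rfl⟩ := Ideal.Quotient.mk_surjective a
    exact Ideal.Quotient.eq_zero_iff_mem.mpr ((hψker f).mp ha)
  let Ψ : FractionRing (MvPolynomial (Fin r) QBar ⧸ I) →ₐ[QBar] RatFunc QBar :=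
    IsFractionRing.liftAlgHom (g := ψ') hinj
  let e := AlgEquiv.ofInjectiveField Ψ
  -- Lüroth's theorem concerns subfields strictly larger than the constants; a nonconstant
  -- coordinate provides this.
  have hE : Ψ.fieldRange ≠ ⊥ := by
    obtain ⟨j, hj⟩ := hp
    intro h
    have h1 : algebraMap QBar[X] (RatFunc QBar) (p j) ∈ Ψ.fieldRange := by
      refine ⟨algebraMap _ _ (Ideal.Quotient.mk I (MvPolynomial.X j)), ?_⟩
      have h2 : Ψ (algebraMap _ _ (Ideal.Quotient.mk I (MvPolynomial.X j))) =
          ψ (MvPolynomial.X j) := IsFractionRing.lift_algebraMap hinj _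
      rw [hψ, MvPolynomial.aeval_X] at h2
      exact h2
    rw [h, IntermediateField.mem_bot] at h1
    obtain ⟨c, hc⟩ := h1
    rw [IsScalarTower.algebraMap_apply QBar QBar[X] (RatFunc QBar)] at hc
    have h3 := RatFunc.algebraMap_injective QBar hc
    rw [← h3, algebraMap_eq, natDegree_C] at hj
    exact hj rfl
  exact ⟨e.trans (RatFunc.Luroth.algEquiv hE).symm⟩

end ZariskiClosure

/-! ### The closure of an orbit with polynomial coordinates. -/

section OrbitClosure

open OrbitGrowth Polynomial

theorem finite_range_of_eq {α : Type*} {f : α → α} {P : α} {m k : ℕ} (hk : 0 < k)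
    (h : f^[m + k] P = f^[m] P) : (Set.range fun n : ℕ => f^[n] P).Finite := by
  classical
  refine (((Finset.range (m + k)).image fun n => f^[n] P).finite_toSet).subset ?_
  rintro _ ⟨n, rfl⟩
  induction n using Nat.strong_induction_on with
  | _ n ih =>
    rcases lt_or_ge n (m + k) with hn | hn
    · exact Finset.mem_coe.mpr (Finset.mem_image_of_mem _ (Finset.mem_range.mpr hn))
    · have h1 : f^[n] P = f^[n - k] P := by
        rw [show n = (n - (m + k)) + (m + k) by omega, Function.iterate_add_apply, h,
          ← Function.iterate_add_apply]
        congr 1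
        omega
      simp only [h1]
      exact ih (n - k) (by omega)

/-- If the coordinates of an orbit are eventually polynomial along residue classes, then the
closure of the orbit consists of finitely many points and rational curves. -/
theorem exists_curves_of_polynomial {r : ℕ} {f : (Fin r → QBar) → Fin r → QBar} {P : Fin r → QBar}
    {d N : ℕ} {p : Fin d → Fin r → QBar[X]} (hd : 1 ≤ d)
    (hp : ∀ n : ℕ, N ≤ n → ∀ (i : Fin d) (j : Fin r),
      f^[n * d + i] P j = (p i j).eval (n : QBar)) :
    ∃ (F : Set (Fin r → QBar)) (𝒞 : Set (Set (Fin r → QBar))),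
      F.Finite ∧ 𝒞.Finite ∧ (∀ C ∈ 𝒞, IsRationalCurve C) ∧
      zariskiClosure (Set.range fun n : ℕ => f^[n] P) = F ∪ ⋃₀ 𝒞 ∧
      ((Set.range fun n : ℕ => f^[n] P).Infinite →
        ∃ N : ℕ, zariskiClosure (Set.range fun n : ℕ => f^[N + n] P) = ⋃₀ 𝒞) := by
  by_cases hfin : (Set.range fun n : ℕ => f^[n] P).Finite
  · exact ⟨_, ∅, hfin, Set.finite_empty, by simp, by simp [zariskiClosure_of_finite hfin],
      fun h => absurd hfin h⟩
  -- If all coordinates were constant on one residue class, the orbit would return to the same point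
  -- and be finite.
  have hnonconst : ∀ i, ∃ j, (p i j).natDegree ≠ 0 := by
    intro i
    by_contra! hcon
    refine hfin (finite_range_of_eq (m := N * d + i) (k := d) hd ?_)
    ext j
    obtain ⟨c, hc⟩ := natDegree_eq_zero.mp (hcon j)
    rw [show N * d + (i : ℕ) + d = (N + 1) * d + i by ring, hp _ (Nat.le_succ N), hp _ le_rfl, ← hc,
      eval_C, eval_C]
  have htail : (Set.range fun n : ℕ => f^[N * d + n] P) =
      ⋃ i ∈ (Finset.univ : Finset (Fin d)), integerPoints (p i) N := by
    ext x
    simp only [Set.mem_range, Set.mem_iUnion, Finset.mem_univ, exists_prop, true_and]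
    constructor
    · rintro ⟨n, rfl⟩
      refine ⟨⟨n % d, Nat.mod_lt _ hd⟩, N + n / d, Nat.le_add_right _ _, fun j => ?_⟩
      rw [← hp _ (Nat.le_add_right _ _)]
      have h1 : N * d + n = (N + n / d) * d + n % d := by
        have := Nat.div_add_mod n d
        rw [add_mul, mul_comm (n / d)]
        linarith
      exact congrArg (fun k => f^[k] P j) h1
    · rintro ⟨i, n, hn, hx⟩
      refine ⟨(n - N) * d + i, ?_⟩
      ext j
      rw [hx, ← hp n hn, ← add_assoc, ← add_mul, Nat.add_sub_cancel' hn]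
  have hclosure : zariskiClosure (Set.range fun n : ℕ => f^[N * d + n] P) =
      ⋃₀ Set.range fun i => zariskiClosure (integerPoints (p i) N) := by
    rw [htail, zariskiClosure_biUnion, Set.sUnion_range]
    simp
  have hinit : ((fun n : ℕ => f^[n] P) '' Set.Iio (N * d)).Finite :=
    (Set.finite_Iio _).image _
  refine ⟨_, _, hinit, Set.finite_range fun i => zariskiClosure (integerPoints (p i) N), ?_, ?_,
    fun _ => ⟨N * d, hclosure⟩⟩
  · rintro _ ⟨i, rfl⟩
    exact isRationalCurve_zariskiClosure_integerPoints (hnonconst i) N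
  · rw [← hclosure, ← zariskiClosure_of_finite hinit, ← zariskiClosure_union]
    congr 1
    ext x
    simp only [Set.mem_range, Set.mem_union, Set.mem_image, Set.mem_Iio]
    constructor
    · rintro ⟨n, rfl⟩
      rcases lt_or_ge n (N * d) with hn | hn
      · exact Or.inl ⟨n, hn, rfl⟩
      · exact Or.inr ⟨n - N * d, by rw [Nat.add_sub_cancel' hn]⟩
    · rintro (⟨n, -, rfl⟩ | ⟨n, rfl⟩)
      · exact ⟨n, rfl⟩
      · exact ⟨_, rfl⟩

end OrbitClosure

/-! ### Orbits of small height. -/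

section SmallOrbits

open OrbitGrowth

theorem exists_affineHeight_le_of_orbitGrowth_lt {r : ℕ}
    {f : Fin r → MvPolynomial (Fin r) QBar} {P : Fin r → QBar} {b : ℝ} (hb : 0 < b)
    (h : orbitGrowth f P < (b : EReal)) :
    ∃ C c : ℝ, 0 ≤ C ∧ 0 < c ∧ c < b ∧
      ∀ n : ℕ, affineHeight ((regularMap f)^[n] P) ≤ C * (n + 1 : ℝ) ^ c := by
  -- The maximum with `0` makes `c` positive even if the upper limit is negative or `-∞`.
  obtain ⟨c, hc1, hc2⟩ := EReal.lt_iff_exists_real_btwn.mp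
    (max_lt h (show (0 : EReal) < b by exact_mod_cast hb))
  have hc0 : 0 < c := by exact_mod_cast (le_max_right _ _).trans_lt hc1
  have hcb : c < b := by exact_mod_cast hc2
  have hev := eventually_lt_of_limsup_lt ((le_max_left _ _).trans_lt hc1)
  obtain ⟨N, hN⟩ := (hev.and (eventually_ge_atTop 2)).exists_forall_of_atTop
  set u : ℕ → ℝ := fun n => affineHeight ((regularMap f)^[n] P)
  have hbig : ∀ n, N ≤ n → u n ≤ (n + 1 : ℝ) ^ c := by
    intro n hn
    obtain ⟨h1, h2⟩ := hN n hn
    rcases le_or_gt (u n) 0 with h0 | h0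
    · exact h0.trans (by positivity)
    have hn1 : (1 : ℝ) < n := by exact_mod_cast h2
    have hlog : 0 < Real.log n := Real.log_pos hn1
    have h3 : ENNReal.log (ENNReal.ofReal (u n)) / ((Real.log n : ℝ) : EReal) =
        ((Real.log (u n) / Real.log n : ℝ) : EReal) := by
      rw [ENNReal.log_ofReal_of_pos h0, EReal.coe_div]
    have h4 : Real.log (u n) / Real.log n < c := by
      have : ((Real.log (u n) / Real.log n : ℝ) : EReal) < c := h3 ▸ h1
      exact_mod_cast this
    rw [div_lt_iff₀ hlog, ← Real.log_rpow (by linarith)] at h4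
    have h5 := (Real.log_lt_log_iff h0 (by positivity)).mp h4
    refine h5.le.trans ?_
    gcongr
    linarith
  -- The sum absorbs the finitely many terms before the limsup bound holds.
  refine ⟨1 + ∑ n ∈ Finset.range N, |u n|, c, by positivity, hc0, hcb, fun n => ?_⟩
  have hsum : 0 ≤ ∑ n ∈ Finset.range N, |u n| := by positivity
  have hone : (1 : ℝ) ≤ (n + 1 : ℝ) ^ c := Real.one_le_rpow (by linarith [Nat.cast_nonneg (α := ℝ) n]) hc0.le
  rcases lt_or_ge n N with hn | hn
  · have h1 : |u n| ≤ ∑ n ∈ Finset.range N, |u n| :=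
      Finset.single_le_sum (f := fun n => |u n|) (fun _ _ => abs_nonneg _) (Finset.mem_range.mpr hn)
    have h2 := le_abs_self (u n)
    change u n ≤ _
    nlinarith
  · have := hbig n hn
    change u n ≤ _
    nlinarith

/-- A point and a polynomial map over the algebraic numbers are defined over a number field. -/
theorem exists_descent {r : ℕ} (f : Fin r → MvPolynomial (Fin r) QBar) (P : Fin r → QBar) :
    ∃ (m : ℕ) (z : Fin m → QBar) (F : Fin r → MvPolynomial (Fin r) (coordinateField z))
      (Q : Fin r → coordinateField z),
      (∀ i, MvPolynomial.map (algebraMap (coordinateField z) QBar) (F i) = f i) ∧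
      ∀ i, algebraMap (coordinateField z) QBar (Q i) = P i := by
  set T : Set QBar := Set.range P ∪ ⋃ i, ((f i).coeffs : Set QBar)
  have hT : T.Finite := (Set.finite_range P).union
    (Set.finite_iUnion fun i => (f i).coeffs.finite_toSet)
  obtain ⟨m, z, -, hz⟩ := hT.fin_param
  have hmem : ∀ t ∈ T, t ∈ coordinateField z := fun t ht =>
    IntermediateField.subset_adjoin ℚ _ (by rw [hz]; exact ht)
  have hF : ∀ i, ∃ F : MvPolynomial (Fin r) (coordinateField z),
      MvPolynomial.map (algebraMap (coordinateField z) QBar) F = f i := by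
    intro i
    refine MvPolynomial.mem_range_map_iff_coeffs_subset.mpr ?_
    intro t ht
    exact ⟨⟨t, hmem t (Or.inr (Set.mem_iUnion.mpr ⟨i, ht⟩))⟩, rfl⟩
  choose F hF using hF
  exact ⟨m, z, F, fun i => ⟨P i, hmem _ (Or.inl ⟨i, rfl⟩)⟩, hF, fun i => rfl⟩

open Polynomial in
/-- The coordinates of an orbit of small height satisfy linear recurrences. -/
theorem exists_recurrence_of_orbit {K : Type*} [Field K] [NumberField K] {r : ℕ} (hr : 1 ≤ r)
    {F : Fin r → MvPolynomial (Fin r) K} {x : ℕ → Fin r → K}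
    (hx : ∀ n i, x (n + 1) i = MvPolynomial.eval (x n) (F i))
    {C c : ℝ} (hC : 0 ≤ C) (hc : 0 < c) (hcr : c < 1 / r)
    (hinf : ∀ (w : InfinitePlace K) (n : ℕ) j, w (x n j) ≤ Real.exp (C * (n + 1 : ℝ) ^ c))
    (hfin : ∀ (v : FinitePlace K) (n : ℕ) j, v (x n j) ≤ Real.exp (C * (n + 1 : ℝ) ^ c))
    (j : Fin r) : ∃ q : K[X], q ≠ 0 ∧ aeval (seqShift K) q (fun n => x n j) = 0 := by
  have hbad : ((⋃ i, {v : FinitePlace K | x 0 i ∉ placeLocalRing v}) ∪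
      ⋃ i, ⋃ d ∈ (F i).support, {v : FinitePlace K | (F i).coeff d ∉ placeLocalRing v}).Finite :=
    (Set.finite_iUnion fun i => finite_setOf_notMem_placeLocalRing _).union
      (Set.finite_iUnion fun i => (F i).support.finite_toSet.biUnion fun d _ =>
        finite_setOf_notMem_placeLocalRing _)
  refine exists_recurrence_of_hankel_det_eq_zero
    (hankel_det_eventually_eq_zero hr (S := hbad.toFinset) (fun v hv => ?_) hC hc hcr
      (fun w n => hinf w n j) (fun v n => hfin v n j))
  rw [Set.Finite.mem_toFinset] at hv
  simp only [Set.mem_union, Set.mem_iUnion, not_or, not_exists, Set.mem_ofPred_eq, not_not] at hv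
  obtain ⟨h1, t, k, hk, htk, hper⟩ := exists_period_of_orbit (fun i d hd => hv.2 i d hd) hv.1 hx
  exact ⟨fun n => h1 n j, t, k, hk, htk, fun n hn => hper n hn j⟩

open Polynomial in
theorem aeval_seqShift_map {K L : Type*} [Field K] [Field L] (φ : K →+* L) {q : K[X]} {a : ℕ → K}
    (h : aeval (seqShift K) q a = 0) :
    aeval (seqShift L) (q.map φ) (fun n => φ (a n)) = 0 := by
  ext n
  have h1 := congrFun h n
  rw [aeval_seqShift_apply, Pi.zero_apply] at h1 ⊢
  rw [natDegree_map]
  simp only [coeff_map, ← map_mul, ← map_sum, h1, map_zero]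

/-- The coordinates of an orbit whose height grows slowly are eventually polynomial along residue
classes. -/
theorem exists_eventuallyPolynomialMod_of_orbitGrowth_lt {r : ℕ} (hr : 1 ≤ r)
    {f : Fin r → MvPolynomial (Fin r) QBar} {P : Fin r → QBar}
    (h : orbitGrowth f P < ((1 / (r : ℝ) : ℝ) : EReal)) (j : Fin r) :
    ∃ d : ℕ, 0 < d ∧ EventuallyPolynomialMod (fun n => (regularMap f)^[n] P j) d := by
  have hr0 : (0 : ℝ) < r := by exact_mod_cast hr
  obtain ⟨C, c, hC, hc, hcr, hh⟩ := exists_affineHeight_le_of_orbitGrowth_lt (by positivity) h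
  obtain ⟨m, z, F, Q, hF, hQ⟩ := exists_descent f P
  let K := coordinateField z
  let x : ℕ → Fin r → K := fun n => (fun y i => MvPolynomial.eval y (F i))^[n] Q
  have hx : ∀ n i, x (n + 1) i = MvPolynomial.eval (x n) (F i) := fun n i => by
    simp only [x, Function.iterate_succ_apply']
  have hxP : ∀ n i, algebraMap K QBar (x n i) = (regularMap f)^[n] P i := by
    intro n
    induction n with
    | zero => exact hQ
    | succ n ih =>
      intro i
      rw [hx, Function.iterate_succ_apply', regularMap, ← hF, MvPolynomial.eval_map, ← funext ih]
      exact MvPolynomial.eval₂_comp_left (algebraMap K QBar) (RingHom.id K) (x n) (F i)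
  set D : ℝ := ((Module.finrank ℚ K : ℕ) : ℝ) with hD
  have hD1 : 1 ≤ D := by
    have : 0 < Module.finrank ℚ K := Module.finrank_pos
    rw [hD]
    exact_mod_cast this
  have hsize : ∀ (n : ℕ) i, SizeLE (Real.exp (D * C * (n + 1 : ℝ) ^ c)) ((regularMap f)^[n] P i) := by
    intro n i
    have hle : coordinateField ((regularMap f)^[n] P) ≤ K := by
      rw [IntermediateField.adjoin_le_iff]
      rintro _ ⟨i, rfl⟩
      rw [← hxP n i]
      exact (x n i).2
    have hfr : (Module.finrank ℚ (coordinateField ((regularMap f)^[n] P)) : ℝ) ≤ D := by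
      rw [hD]
      exact_mod_cast LinearMap.finrank_le_finrank_of_injective
        (f := (IntermediateField.inclusion hle).toLinearMap)
        (IntermediateField.inclusion_injective hle)
    refine (sizeLE_of_affineHeight hfr i).mono ?_
    rw [mul_assoc]
    gcongr
    exact hh n
  have hsizeK : ∀ (n : ℕ) i, SizeLE (Real.exp (D * C * (n + 1 : ℝ) ^ c)) (algebraMap K QBar (x n i)) :=
    fun n i => by rw [hxP]; exact hsize n i
  have hDC : 0 ≤ D * C := by positivity
  -- One factor `D` passes from the absolute to the relative height; the other comes from the
  -- denominators at finite places.
  obtain ⟨q, hq0, hq⟩ := exists_recurrence_of_orbit hr hx (C := D * (D * C)) (by positivity) hc hcr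
    (fun w n i => (infinitePlace_le_of_sizeLE (hsizeK n i) w).trans (by
      gcongr
      exact le_mul_of_one_le_left hC hD1))
    (fun v n i => (finitePlace_le_of_sizeLE (hsizeK n i) v).trans (by
      rw [← Real.exp_nat_mul]
      apply le_of_eq
      congr 1
      rw [hD]
      ring)) j
  have hc1 : c < 1 := hcr.trans_le (by
    rw [div_le_one hr0]
    exact_mod_cast hr)
  refine exists_eventuallyPolynomialMod_of_sizeLE (A := D * C) hDC hc.le hc1 (fun n => hsize n j)
    ⟨q.map (algebraMap K QBar), (Polynomial.map_ne_zero_iff (algebraMap K QBar).injective).mpr hq0,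
      ?_⟩
  have := aeval_seqShift_map (algebraMap K QBar) hq
  simpa only [hxP] using this

end SmallOrbits

/-- Either the Zariski closure of the forward orbit is a union of finitely many points and
finitely many rational curves (of curves only, if the orbit is infinite and a finite initial
segment of it is dropped) and the coordinates are eventually polynomial along the residue
classes modulo some `d ≥ 1`, or the affine height grows at least like `n ^ (1 / r)` in the sense
of the upper limit. -/
theorem corollary1p5 (r : ℕ) (hr : 1 ≤ r)
    (f : Fin r → MvPolynomial (Fin r) OrbitGrowth.QBar) (P : Fin r → OrbitGrowth.QBar) :
    ((∃ (F : Set (Fin r → OrbitGrowth.QBar)) (𝒞 : Set (Set (Fin r → OrbitGrowth.QBar))),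
        F.Finite ∧ 𝒞.Finite ∧ (∀ C ∈ 𝒞, OrbitGrowth.IsRationalCurve C) ∧
        OrbitGrowth.zariskiClosure (Set.range fun n : ℕ => (OrbitGrowth.regularMap f)^[n] P) =
          F ∪ ⋃₀ 𝒞 ∧
        ((Set.range fun n : ℕ => (OrbitGrowth.regularMap f)^[n] P).Infinite →
          ∃ N : ℕ, OrbitGrowth.zariskiClosure
            (Set.range fun n : ℕ => (OrbitGrowth.regularMap f)^[N + n] P) = ⋃₀ 𝒞)) ∧
      (∃ (d N : ℕ) (p : Fin d → Fin r → Polynomial OrbitGrowth.QBar), 1 ≤ d ∧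
        ∀ n : ℕ, N ≤ n → ∀ (i : Fin d) (j : Fin r),
          (OrbitGrowth.regularMap f)^[n * d + i] P j =
            (p i j).eval (n : OrbitGrowth.QBar))) ∨
    ((1 / (r : ℝ) : ℝ) : EReal) ≤ OrbitGrowth.orbitGrowth f P := by
  refine or_iff_not_imp_right.mpr fun h => ?_
  choose e he hpoly using exists_eventuallyPolynomialMod_of_orbitGrowth_lt hr (not_le.mp h)
  -- A common modulus for all coordinates.
  set d := ∏ j, e j
  have hd : 0 < d := Finset.prod_pos fun j _ => he j
  have hall := fun j => (hpoly j).of_dvd (Finset.dvd_prod_of_mem e (Finset.mem_univ j)) hd.ne'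
  choose N p hp using hall
  have hpoly' : ∀ n : ℕ, (∑ j, ∑ i : Fin d, N j i) ≤ n → ∀ (i : Fin d) (j : Fin r),
      (OrbitGrowth.regularMap f)^[n * d + i] P j = (p j i).eval (n : OrbitGrowth.QBar) := by
    intro n hn i j
    refine hp j i n (le_trans ?_ hn)
    exact (Finset.single_le_sum (f := fun i : Fin d => N j i) (fun _ _ => Nat.zero_le _)
      (Finset.mem_univ i)).trans
      (Finset.single_le_sum (f := fun j => ∑ i : Fin d, N j i) (fun _ _ => Nat.zero_le _)
        (Finset.mem_univ j))
  exact ⟨exists_curves_of_polynomial (p := fun i j => p j i) hd hpoly', d, _, fun i j => p j i, hd,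
    hpoly'⟩
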